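/- For $0<s<1$ and $x>0$ let $$h_s(x)=\frac{x}{\sqrt{2\pi(1-s)^3}}\,e^{-\frac{x^2}{2(1-s)}} ,$$ and let $\mathcal F$ be the Fourier sine transform on $L^2((0,\infty),dx)$, that is, the continuous extension to $L^2$ of the operator $\mathcal F\varphi(y)=\sqrt{2/\pi}\int_0^\infty \varphi(x)\sin(xy)\,dx$ on smooth $\varphi:(0,\infty)\to\mathbb C$ with compact support. Let $\mathbb B^{\rm ex}=(\mathbb B^{\rm ex}_s)_{0\le s\le 1}$ be the normalized Brownian excursion, i.e. the continuous process with $\mathbb B^{\rm ex}_0=\mathbb B^{\rm ex}_1=0$ which is Markov with transition densities (for $x_1,x_2>0$) $$p_{0,s_2}(0,x_2)=\sqrt{8\pi}\,h_{s_2}(x_2)h_{1-s_2}(x_2),\qquad p_{s_1,s_2}(x_1,x_2)=\frac{h_{s_2}(x_2)}{h_{s_1}(x_1)}\,\frac{e^{-\frac{(x_1-x_2)^2}{2(s_2-s_1)}}-e^{-\frac{(x_1+x_2)^2}{2(s_2-s_1)}}}{\sqrt{2\pi(s_2-s_1)}}\qquad(0<s_1<s_2<1).$$ Let $Y=(Y_t)_{t\ge0}$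 be the radial part (Euclidean norm) of a rotation-invariant three-dimensional Cauchy process, i.e. of the Lévy process in $\mathbb R^3$ whose increments over time intervals of length $t$ have density $t\,\pi^{-2}(t^2+\|x\|^2)^{-2}$. **Proposition.** Let $n\ge 0$ and $0=t_0<t_1<\dots<t_n$, and write $\Delta u_k=u_{k+1}-u_k$. (a) Let $0<s_0<s_1<\dots<s_n<1$, and let $f,g:(0,\infty)\to\mathbb C$ be functions such that $h_{s_n}f\in L^2((0,\infty),dx)$ and $y\,g(y)=[\mathcal F(h_{s_n}f)](y)$ (as elements of $L^2((0,\infty),dy)$). Then $$\mathbb E\Big[e^{-\sum_{k=0}^{n-1}\Delta t_k\,\mathbb B^{\rm ex}_{s_k}}f(\mathbb B^{\rm ex}_{s_n})\Big]=2\int_0^\infty\mathbb E\Big[e^{-\frac12\sum_{k=0}^{n-1}\Delta s_k\,Y_{t_{k+1}}^2}g(Y_{t_n})\,\Big|\,Y_0=y\Big]\,y^2e^{-\frac12 s_0y^2}\,dy ,$$ where both expectations (the second one for every $y>0$) and the integral over $y$ converge absolutely. (b) For $0=\tilde s_0<\tilde s_1<\dots<\tilde s_n<\tilde s_{n+1}=1$,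 $$\mathbb E\Big[e^{-\sum_{k=1}^{n}(t_k-t_{k-1})\,\mathbb B^{\rm ex}_{\tilde s_k}}\Big]=\sqrt{\frac2\pi}\int_0^\infty\mathbb E\Big[e^{-\frac12\sum_{k=0}^{n}(\tilde s_{k+1}-\tilde s_k)\,Y_{t_k}^2}\,\Big|\,Y_0=y\Big]\,y^2\,dy ,$$ where the expectation on the left and the integral over $y$ converge absolutely. -/

import Mathlib

open MeasureTheory ProbabilityTheory Filter Set Topology
open scoped ENNReal NNReal

noncomputable section

namespace DualLaplace

/-! ### The normalized Brownian excursion -/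

/-- The function `h_s(x) = x / √(2π (1-s)³) · exp(-x² / (2(1-s)))`, for `0 < s < 1` and `x > 0`. -/
def h (s x : ℝ) : ℝ :=
  x / Real.sqrt (2 * Real.pi * (1 - s) ^ 3) * Real.exp (-(x ^ 2) / (2 * (1 - s)))

/-- The transition density of Brownian motion on `(0, ∞)` killed when it hits zero. -/
def killedKernel (t x₁ x₂ : ℝ) : ℝ :=
  1 / Real.sqrt (2 * Real.pi * t) * Real.exp (-((x₁ - x₂) ^ 2) / (2 * t)) -
    1 / Real.sqrt (2 * Real.pi * t) * Real.exp (-((x₁ + x₂) ^ 2) / (2 * t))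

open Classical in
/-- The transition density `p_{s₁,s₂}(x₁,x₂)` of the normalized Brownian excursion for
`0 ≤ s₁ < s₂ < 1`: the entrance density from the origin if `s₁ = 0`, `x₁ = 0`, and Doob's
`h`-transform of the killed Brownian motion if `s₁ > 0`, `x₁ > 0`.  It is carried by `x₂ > 0`. -/
def excursionDensity (s₁ s₂ x₁ x₂ : ℝ) : ℝ :=
  if s₁ = 0 ∧ x₁ = 0 ∧ 0 < x₂ then
    Real.sqrt (8 * Real.pi) * h s₂ x₂ * h (1 - s₂) x₂
  else if 0 < s₁ ∧ 0 < x₁ ∧ 0 < x₂ then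
    h s₂ x₂ / h s₁ x₁ * killedKernel (s₂ - s₁) x₁ x₂
  else 0

/-- `B` is a normalized Brownian excursion under `μ`: a process on `[0,1]` with continuous paths,
tied to `0` at both ends, which is Markov with the transition densities `excursionDensity`.  The
Markov property is expressed by the finite-dimensional distributions: `(B_{u_0}, …, B_{u_m})` has
density `p_{0,u_0}(0,x_0) ∏ p_{u_k,u_{k+1}}(x_k,x_{k+1})` for `0 < u_0 < ⋯ < u_m < 1`. -/
structure IsBrownianExcursion {Ω : Type*} [MeasurableSpace Ω]
    (B : unitInterval → Ω → ℝ) (μ : Measure Ω) : Prop where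
  measurable : ∀ s, Measurable (B s)
  continuous_paths : ∀ᵐ ω ∂μ, Continuous fun s => B s ω
  start_zero : ∀ᵐ ω ∂μ, B 0 ω = 0
  end_zero : ∀ᵐ ω ∂μ, B 1 ω = 0
  finite_dim : ∀ (m : ℕ) (u : Fin (m + 1) → unitInterval), StrictMono u →
    0 < u 0 → u (Fin.last m) < 1 →
    HasLaw (fun ω i => B (u i) ω)
      ((volume : Measure (Fin (m + 1) → ℝ)).withDensity fun x =>
        ENNReal.ofReal (excursionDensity 0 (u 0) 0 (x 0) *
          ∏ k : Fin m, excursionDensity (u k.castSucc) (u k.succ) (x k.castSucc) (x k.succ))) μ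

/-! ### The three-dimensional Cauchy process and its radial part -/

/-- The (rotation invariant) Cauchy distribution on `ℝ³` with scale `t > 0`, of density
`t / (π² (t² + ‖x‖²)²)`; its characteristic function is `ξ ↦ exp(-t‖ξ‖)`. -/
def cauchyLaw (t : ℝ) : Measure (EuclideanSpace ℝ (Fin 3)) :=
  volume.withDensity fun x => ENNReal.ofReal (t / (Real.pi ^ 2 * (t ^ 2 + ‖x‖ ^ 2) ^ 2))

/-- Under `P`, the process `Z` is a three-dimensional Cauchy process started at `x`: the Lévy
process (independent stationary increments, càdlàg paths) with Cauchy distributed increments. -/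
structure IsCauchyProcess {Ω : Type*} [MeasurableSpace Ω]
    (Z : ℝ≥0 → Ω → EuclideanSpace ℝ (Fin 3)) (x : EuclideanSpace ℝ (Fin 3))
    (P : Measure Ω) : Prop where
  measurable : ∀ t, Measurable (Z t)
  start : ∀ᵐ ω ∂P, Z 0 ω = x
  indep_increments : HasIndepIncrements Z P
  increment_law : ∀ r t : ℝ≥0, r < t → HasLaw (Z t - Z r) (cauchyLaw ((t : ℝ) - r)) P
  cadlag : ∀ᵐ ω ∂P, ∀ t : ℝ≥0, ContinuousWithinAt (fun u => Z u ω) (Ici t) t ∧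
    ∃ l, Tendsto (fun u => Z u ω) (𝓝[<] t) (𝓝 l)

/-- Under `P`, the process `Y` is the radial part (Euclidean norm) of a three-dimensional Cauchy
process, started at radius `y`. -/
def IsRadialCauchyProcess {Ω : Type*} [MeasurableSpace Ω]
    (Y : ℝ≥0 → Ω → ℝ) (y : ℝ) (P : Measure Ω) : Prop :=
  ∃ (Z : ℝ≥0 → Ω → EuclideanSpace ℝ (Fin 3)) (x : EuclideanSpace ℝ (Fin 3)),
    ‖x‖ = y ∧ IsCauchyProcess Z x P ∧ ∀ t ω, Y t ω = ‖Z t ω‖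

/-! ### The Fourier sine transform on `L²((0,∞), dx)` -/

/-- Lebesgue measure on `(0, ∞)`. -/
def halfLine : Measure ℝ := volume.restrict (Ioi 0)

/-- The sine integral `√(2/π) ∫₀^∞ φ(x) sin(xy) dx`. -/
def sineIntegral (φ : ℝ → ℂ) (y : ℝ) : ℂ :=
  (Real.sqrt (2 / Real.pi) : ℂ) * ∫ x in Ioi (0 : ℝ), φ x * (Real.sin (x * y) : ℂ)

/-- `v` is the Fourier sine transform of `u` in `L²((0,∞), dx)`.  This is the graph of the
continuous extension to `L²` of the sine integral on smooth functions with compact support in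
`(0,∞)`: there are such functions `φ m → u` in `L²` whose sine integrals converge to `v` in `L²`.
(The values of `u` and `v` outside `(0,∞)`, or on a null set, play no role.) -/
def IsFourierSineTransform (u v : ℝ → ℂ) : Prop :=
  MemLp u 2 halfLine ∧ MemLp v 2 halfLine ∧
    ∃ φ : ℕ → ℝ → ℂ,
      (∀ m, ContDiff ℝ (⊤ : ℕ∞) (φ m) ∧ HasCompactSupport (φ m) ∧ tsupport (φ m) ⊆ Ioi 0) ∧
      Tendsto (fun m => eLpNorm (fun x => φ m x - u x) 2 halfLine) atTop (𝓝 0) ∧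
      Tendsto (fun m => eLpNorm (fun y => sineIntegral (φ m) y - v y) 2 halfLine) atTop (𝓝 0)

end DualLaplace

end

/-! The sine transform diagonalises both processes. If `D` is a symmetric density with cosine
transform `m`, its odd reflection D(y-z) - D(y+z) is a kernel on the half-line with eigenfunctions
sin(x·) and eigenvalues m(x) (`integral_reflected_mul_sin`). For the Gaussian of variance b this is
the kernel of killed Brownian motion, with m(x) = exp(-bx²/2). For the Cauchy density of scale t,
m(x) = exp(-t|x|), and ρ/r times the reflected kernel is the transition density of the radial
three-dimensional Cauchy process (`lintegral_cauchyLaw`). So the sine transform turns a step of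
either process into the exponential weight attached to the other.

The excursion is an h-transform of killed Brownian motion, so the quotients of h telescope and the
weighted law of its last position has density h times `killedPart` (`chainDensity_excursion`). The
quotients ρ/r telescope in the same way: from the initial measure 2y² exp(-s₀y²/2) dy, the weighted
law of the last radius has density y times `radialPart` (`radialKernel_comp_withDensity`).
Alternating the two transform rules shows that `killedPart` is the sine transform of `radialPart`
(`killedPart_eq_sineTransform`). Parseval, which pairs `killedPart` with hf and `radialPart` with
yg, then gives (a).

All functions paired are in L², which yields absolute convergence of the left side and of the
integral over y. The inner expectation must converge for every y, not just almost every y; this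
rests on a bound of the transition density uniform in the starting radius (`radialDensity_le`). Part
(b) is the case f = 1, with an auxiliary last time and an explicit g. -/

noncomputable section

namespace DualLaplace

/-! ### Reflected kernels of symmetric densities -/

/-- A continuous, symmetric, unimodal probability density `D` on `ℝ` with cosine transform `m`. -/
structure CosDensity (D m : ℝ → ℝ) : Prop where
  continuous : Continuous D
  anti : ∀ x y, |x| ≤ |y| → D y ≤ D x
  nonneg : ∀ x, 0 ≤ D x
  integrable : Integrable D
  integral_eq_one : ∫ x, D x = 1
  cos_transform : ∀ x, ∫ w, D w * Real.cos (x * w) = m x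

/-- The kernel on `(0, ∞)` obtained from the convolution kernel of `D` by odd reflection. -/
def reflected (D : ℝ → ℝ) (y z : ℝ) : ℝ := D (y - z) - D (y + z)

lemma continuous_reflected {D : ℝ → ℝ} (hD : Continuous D) :
    Continuous (Function.uncurry (reflected D)) := by
  unfold Function.uncurry reflected; fun_prop

namespace CosDensity
variable {D m : ℝ → ℝ} (hD : CosDensity D m)
include hD

lemma even (x : ℝ) : D (-x) = D x :=
  le_antisymm (hD.anti _ _ (by simp)) (hD.anti _ _ (by simp))

/-- For nonnegative y and z, |y - z| ≤ y + z, so unimodality applies. -/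
lemma reflected_nonneg {y z : ℝ} (hy : 0 ≤ y) (hz : 0 ≤ z) : 0 ≤ reflected D y z := by
  refine sub_nonneg.2 (hD.anti _ _ ?_)
  rw [abs_of_nonneg (add_nonneg hy hz), abs_le]
  constructor <;> linarith

lemma reflected_comm (y z : ℝ) : reflected D y z = reflected D z y := by
  unfold reflected
  rw [← hD.even, neg_sub, add_comm]

lemma integrable_reflected (y : ℝ) : Integrable (reflected D y) := by
  refine ((hD.integrable.comp_sub_left y)).sub (hD.integrable.comp_add_left y)

/-- The kernel is sub-Markov: dropping the reflected term leaves at most the total mass of `D`. -/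
lemma integral_reflected_le (y : ℝ) : ∫ z in Ioi 0, reflected D y z ≤ 1 := by
  calc ∫ z in Ioi 0, reflected D y z ≤ ∫ z in Ioi 0, D (y - z) := by
        refine setIntegral_mono (hD.integrable_reflected y).integrableOn
          (hD.integrable.comp_sub_left y).integrableOn fun z => ?_
        unfold reflected
        linarith [hD.nonneg (y + z)]
    _ ≤ ∫ z, D (y - z) := setIntegral_le_integral (hD.integrable.comp_sub_left y)
        (ae_of_all _ fun z => hD.nonneg _)
    _ = 1 := by rw [integral_sub_left_eq_self D volume y, hD.integral_eq_one]

lemma integral_sin (x : ℝ) : ∫ w, D w * Real.sin (x * w) = 0 := by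
  have h := integral_neg_eq_self (fun w => D w * Real.sin (x * w)) volume
  simp only [hD.even, mul_neg, Real.sin_neg, integral_neg] at h
  linarith

/-- Since sine is odd, the reflected term supplies the missing negative half-line, so the integral
is the full convolution of `D` with a sine. In the addition formula only the cosine part survives,
`D` being even. -/
lemma integral_reflected_mul_sin (x y : ℝ) :
    ∫ z in Ioi 0, reflected D y z * Real.sin (x * z) = m x * Real.sin (x * y) := by
  have hb : ∀ f : ℝ → ℝ, Integrable f → Integrable fun z => f z * Real.sin (x * z) := fun f hf =>
    hf.mul_bdd (c := 1) (by fun_prop) (ae_of_all _ fun z => by simpa using Real.abs_sin_le_one _)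
  have hc : ∀ f : ℝ → ℝ, Integrable f → Integrable fun z => f z * Real.cos (x * z) := fun f hf =>
    hf.mul_bdd (c := 1) (by fun_prop) (ae_of_all _ fun z => by simpa using Real.abs_cos_le_one _)
  have h1 := hb _ (hD.integrable.comp_sub_left y)
  have h2 := hb _ (hD.integrable.comp_add_left y)
  have e1 : ∫ z in Ioi 0, reflected D y z * Real.sin (x * z) =
      (∫ z in Ioi 0, D (y - z) * Real.sin (x * z)) -
        ∫ z in Ioi 0, D (y + z) * Real.sin (x * z) := by
    rw [← integral_sub h1.integrableOn h2.integrableOn]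
    simp only [reflected, sub_mul]
  have e2 : ∫ z in Ioi 0, D (y + z) * Real.sin (x * z) =
      -∫ z in Iic 0, D (y - z) * Real.sin (x * z) := by
    have := integral_comp_neg_Ioi 0 (fun z => D (y - z) * Real.sin (x * z))
    simp only [neg_zero] at this
    rw [← this, ← integral_neg]
    refine integral_congr_ae (ae_of_all _ fun z => ?_)
    simp
  have e3 : ∫ z, D (y - z) * Real.sin (x * z) = ∫ w, D w * Real.sin (x * (y - w)) := by
    rw [← integral_sub_left_eq_self _ volume y]
    simp
  rw [e1, e2, sub_neg_eq_add, add_comm,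
    intervalIntegral.integral_Iic_add_Ioi h1.integrableOn h1.integrableOn, e3]
  have : ∀ w, D w * Real.sin (x * (y - w)) =
      Real.sin (x * y) * (D w * Real.cos (x * w)) - Real.cos (x * y) * (D w * Real.sin (x * w)) := by
    intro w; rw [mul_sub, Real.sin_sub]; ring
  simp_rw [this]
  rw [integral_sub ((hc _ hD.integrable).const_mul _) ((hb _ hD.integrable).const_mul _),
    integral_const_mul, integral_const_mul, hD.cos_transform, hD.integral_sin]
  ring

end CosDensity

/-! ### The Gaussian density -/

/-- The centred Gaussian density of variance `b`. -/
def gaussianDensity (b w : ℝ) : ℝ := 1 / √(2 * Real.pi * b) * Real.exp (-(w ^ 2) / (2 * b))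

lemma killedKernel_eq_reflected (b : ℝ) : killedKernel b = reflected (gaussianDensity b) := rfl

lemma integrable_exp_neg_sq {b : ℝ} (hb : 0 < b) : Integrable fun y => Real.exp (-(b * y ^ 2)) := by
  simpa using integrable_exp_neg_mul_sq hb

/-- Real part of the Fourier integral of a Gaussian. -/
lemma integral_exp_neg_sq_mul_cos {c : ℝ} (hc : 0 < c) (x : ℝ) :
    ∫ w, Real.exp (-(c * w ^ 2)) * Real.cos (x * w) =
      √(Real.pi / c) * Real.exp (-(x ^ 2) / (4 * c)) := by
  have h := fourierIntegral_gaussian (b := (c : ℂ)) (by simpa using hc) (x : ℂ)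
  have hint : Integrable fun w : ℝ => Complex.exp (Complex.I * x * w) * Complex.exp (-c * w ^ 2) := by
    have := (integrable_exp_neg_sq hc).ofReal (𝕜 := ℂ)
    refine (this.bdd_mul (c := 1) (f := fun w : ℝ => Complex.exp (Complex.I * x * w))
      (by fun_prop) (ae_of_all _ fun w => ?_)).congr (ae_of_all _ fun w => ?_)
    · rw [show Complex.I * x * w = ((x * w : ℝ) : ℂ) * Complex.I by push_cast; ring,
        Complex.norm_exp_ofReal_mul_I]
    · simp
  have h2 := congrArg Complex.re h
  rw [← RCLike.re_eq_complex_re, ← integral_re hint] at h2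
  have e : ∀ w : ℝ, RCLike.re (Complex.exp (Complex.I * x * w) * Complex.exp (-c * w ^ 2)) =
      Real.exp (-(c * w ^ 2)) * Real.cos (x * w) := by
    intro w
    have : Complex.exp (-c * w ^ 2) = ((Real.exp (-(c * w ^ 2)) : ℝ) : ℂ) := by push_cast; ring_nf
    rw [this, show Complex.I * x * w = ((x * w : ℝ) : ℂ) * Complex.I by push_cast; ring,
      RCLike.re_eq_complex_re, Complex.re_mul_ofReal, Complex.exp_ofReal_mul_I_re, mul_comm]
  simp_rw [e] at h2
  rw [h2, RCLike.re_eq_complex_re]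
  have e3 : ((Real.pi : ℂ) / c) ^ (1 / 2 : ℂ) = ((√(Real.pi / c) : ℝ) : ℂ) := by
    rw [Real.sqrt_eq_rpow, Complex.ofReal_cpow (by positivity)]
    push_cast; rfl
  have e4 : Complex.exp (-(x : ℂ) ^ 2 / (4 * c)) = ((Real.exp (-(x ^ 2) / (4 * c)) : ℝ) : ℂ) := by
    push_cast; rfl
  rw [e3, e4, ← Complex.ofReal_mul, Complex.ofReal_re]

lemma gaussianDensity_eq (b w : ℝ) :
    gaussianDensity b w = 1 / √(2 * Real.pi * b) * Real.exp (-(1 / (2 * b) * w ^ 2)) := by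
  unfold gaussianDensity; congr 2; ring

lemma cosDensity_gaussian {b : ℝ} (hb : 0 < b) :
    CosDensity (gaussianDensity b) fun x => Real.exp (-(b * x ^ 2 / 2)) := by
  have hint := integrable_exp_neg_sq (b := 1 / (2 * b)) (by positivity)
  have hcos : ∀ x, ∫ w, gaussianDensity b w * Real.cos (x * w) = Real.exp (-(b * x ^ 2 / 2)) := by
    intro x
    simp_rw [gaussianDensity_eq, mul_assoc]
    rw [integral_const_mul, integral_exp_neg_sq_mul_cos (by positivity), ← mul_assoc,
      show Real.pi / (1 / (2 * b)) = 2 * Real.pi * b by field_simp,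
      show 2 * (Real.pi * b) = 2 * Real.pi * b by ring,
      one_div_mul_cancel (by positivity), one_mul]
    congr 1; field_simp; ring
  refine ⟨by unfold gaussianDensity; fun_prop, fun x y hxy => ?_, fun x => by
    unfold gaussianDensity; positivity, ?_, by simpa using hcos 0, hcos⟩
  · rw [gaussianDensity_eq, gaussianDensity_eq]
    have := sq_le_sq.2 hxy
    gcongr
  · simp_rw [funext (gaussianDensity_eq b)]
    exact hint.const_mul _

/-! ### The Cauchy density -/

/-- The Cauchy density of scale `t`. -/
def cauchyDensity (t w : ℝ) : ℝ := t / Real.pi * (1 / (t ^ 2 + w ^ 2))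

lemma integrable_cauchyDensity {t : ℝ} (ht : 0 < t) : Integrable (cauchyDensity t) := by
  have := (integrable_inv_one_add_sq.comp_mul_left' (R := t⁻¹) (by positivity)).const_mul
    (1 / (Real.pi * t))
  refine this.congr (ae_of_all _ fun w => ?_)
  unfold cauchyDensity
  have : 0 < t ^ 2 + w ^ 2 := by positivity
  have : 0 < 1 + (t⁻¹ * w) ^ 2 := by positivity
  field_simp

open FourierTransform in
-- The two half-lines contribute 1/(t + iη) and 1/(t - iη) with η = 2πξ, whose sum is 2t/(t² + η²).
lemma fourier_exp_neg_abs {t : ℝ} (ht : 0 < t) (ξ : ℝ) :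
    𝓕 (fun x : ℝ => (Real.exp (-(t * |x|)) : ℂ)) ξ =
      ((2 * Real.pi * cauchyDensity t (2 * Real.pi * ξ) : ℝ) : ℂ) := by
  set η : ℝ := 2 * Real.pi * ξ with hη
  have hp : 0 < ((t : ℂ) - η * Complex.I).re := by simpa using ht
  have hn : (-(t : ℂ) - η * Complex.I).re < 0 := by simpa using ht
  have ep : ∀ x ∈ Iic (0 : ℝ), Complex.exp (((-2 * Real.pi * inner ℝ x ξ : ℝ) : ℂ) * Complex.I) •
      ((Real.exp (-(t * |x|)) : ℝ) : ℂ) = Complex.exp (((t : ℂ) - η * Complex.I) * x) := by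
    intro x hx
    rw [abs_of_nonpos hx, Complex.ofReal_exp, smul_eq_mul, ← Complex.exp_add]
    congr 1
    simp [hη]; ring
  have en : ∀ x ∈ Ioi (0 : ℝ), Complex.exp (((-2 * Real.pi * inner ℝ x ξ : ℝ) : ℂ) * Complex.I) •
      ((Real.exp (-(t * |x|)) : ℝ) : ℂ) = Complex.exp ((-(t : ℂ) - η * Complex.I) * x) := by
    intro x hx
    rw [abs_of_pos hx, Complex.ofReal_exp, smul_eq_mul, ← Complex.exp_add]
    congr 1
    simp [hη]; ring
  rw [Real.fourier_eq', ← intervalIntegral.integral_Iic_add_Ioi (b := 0)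
    ((integrableOn_exp_mul_complex_Iic hp 0).congr_fun (fun x hx => (ep x hx).symm)
      measurableSet_Iic)
    ((integrableOn_exp_mul_complex_Ioi hn 0).congr_fun (fun x hx => (en x hx).symm)
      measurableSet_Ioi),
    setIntegral_congr_fun measurableSet_Iic ep, setIntegral_congr_fun measurableSet_Ioi en,
    integral_exp_mul_complex_Iic hp, integral_exp_mul_complex_Ioi hn]
  have h1 : (t : ℂ) - η * Complex.I ≠ 0 := fun h => by rw [h] at hp; simp at hp
  have h2 : -(t : ℂ) - η * Complex.I ≠ 0 := fun h => by rw [h] at hn; simp at hn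
  have h3 : (t : ℂ) ^ 2 + (η : ℂ) ^ 2 ≠ 0 := by
    have : t ^ 2 + η ^ 2 ≠ 0 := by positivity
    exact_mod_cast this
  have h4 : (Real.pi : ℂ) ≠ 0 := by exact_mod_cast Real.pi_ne_zero
  unfold cauchyDensity
  push_cast
  simp only [mul_zero, Complex.exp_zero]
  field_simp
  ring_nf
  simp only [Complex.I_sq]
  ring

lemma integrable_exp_neg_abs {t : ℝ} (ht : 0 < t) : Integrable fun x : ℝ => Real.exp (-(t * |x|)) := by
  rw [← integrableOn_univ, ← Iic_union_Ioi (a := (0 : ℝ))]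
  refine IntegrableOn.union ?_ ?_
  · refine (integrableOn_exp_mul_Iic ht 0).congr_fun (fun x hx => ?_) measurableSet_Iic
    simp [abs_of_nonpos (mem_Iic.1 hx)]
  · refine (integrableOn_exp_mul_Ioi (neg_lt_zero.2 ht) 0).congr_fun (fun x hx => ?_)
      measurableSet_Ioi
    simp [abs_of_pos (mem_Ioi.1 hx)]

open FourierTransform in
-- Fourier inversion for exp(-t|x|), which is continuous and integrable with integrable transform;
-- the frequency is then rescaled by 2π.
lemma integral_cauchyDensity_mul_cos {t : ℝ} (ht : 0 < t) (x : ℝ) :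
    ∫ w, cauchyDensity t w * Real.cos (x * w) = Real.exp (-(t * |x|)) := by
  have hpi : (0 : ℝ) < 2 * Real.pi := by positivity
  have hF := funext (fourier_exp_neg_abs ht)
  have hint : Integrable fun ξ : ℝ => 2 * Real.pi * cauchyDensity t (2 * Real.pi * ξ) :=
    ((integrable_cauchyDensity ht).comp_mul_left' hpi.ne').const_mul _
  have h := congrFun (Continuous.fourierInv_fourier_eq
    (f := fun x : ℝ => (Real.exp (-(t * |x|)) : ℂ)) (by fun_prop)
    (integrable_exp_neg_abs ht).ofReal (by rw [hF]; exact hint.ofReal)) x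
  rw [hF, Real.fourierInv_eq'] at h
  have h2 := congrArg Complex.re h
  rw [Complex.ofReal_re, ← RCLike.re_eq_complex_re, ← integral_re] at h2
  · rw [← h2]
    have e : ∀ ξ : ℝ, RCLike.re (Complex.exp (((2 * Real.pi * inner ℝ ξ x : ℝ) : ℂ) * Complex.I) •
        ((2 * Real.pi * cauchyDensity t (2 * Real.pi * ξ) : ℝ) : ℂ)) =
        2 * Real.pi * (cauchyDensity t (2 * Real.pi * ξ) * Real.cos (x * (2 * Real.pi * ξ))) := by
      intro ξ
      rw [smul_eq_mul, RCLike.re_eq_complex_re, Complex.re_mul_ofReal,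
        Complex.exp_ofReal_mul_I_re]
      have : inner ℝ ξ x = x * ξ := by simp
      rw [this, show 2 * Real.pi * (x * ξ) = x * (2 * Real.pi * ξ) by ring]
      ring
    simp_rw [e]
    rw [integral_const_mul,
      Measure.integral_comp_mul_left (fun w => cauchyDensity t w * Real.cos (x * w)),
      abs_of_pos (by positivity), smul_eq_mul, mul_inv_cancel_left₀ hpi.ne']
  · simp only [smul_eq_mul]
    refine hint.ofReal.bdd_mul (c := 1) (by fun_prop) (ae_of_all _ fun w => ?_)
    rw [Complex.norm_exp_ofReal_mul_I]

lemma cosDensity_cauchy {t : ℝ} (ht : 0 < t) :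
    CosDensity (cauchyDensity t) fun x => Real.exp (-(t * |x|)) := by
  refine ⟨?_, fun x y hxy => ?_, fun x => by unfold cauchyDensity; positivity,
    integrable_cauchyDensity ht, by simpa using integral_cauchyDensity_mul_cos ht 0,
    integral_cauchyDensity_mul_cos ht⟩
  · have : ∀ w : ℝ, t ^ 2 + w ^ 2 ≠ 0 := fun w => by positivity
    unfold cauchyDensity; fun_prop (disch := assumption)
  · have := sq_le_sq.2 hxy
    unfold cauchyDensity
    gcongr

/-! ### Reflected kernels and the sine transform -/

/-- Bounded integrable nonnegative functions on `(0, ∞)`. -/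
structure IsBddDensity (p : ℝ → ℝ) : Prop where
  measurable : Measurable p
  nonneg : ∀ x, 0 < x → 0 ≤ p x
  bdd : ∃ C, ∀ x, 0 < x → p x ≤ C
  integrable : IntegrableOn p (Ioi 0)

/-- The action of a reflected kernel on functions on `(0, ∞)`. -/
def reflectedConv (D p : ℝ → ℝ) (z : ℝ) : ℝ := ∫ y in Ioi 0, p y * reflected D y z

/-- The sine transform of a real function. -/
def sineTransform (v : ℝ → ℝ) (x : ℝ) : ℝ := √(2 / Real.pi) * ∫ y in Ioi 0, v y * Real.sin (x * y)

namespace CosDensity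
variable {D m : ℝ → ℝ} (hD : CosDensity D m)
include hD

lemma measurable_reflected : Measurable (Function.uncurry (reflected D)) :=
  (continuous_reflected hD.continuous).measurable

lemma measurable_reflectedConv {p : ℝ → ℝ} (hp : Measurable p) :
    Measurable (reflectedConv D p) := by
  refine StronglyMeasurable.measurable ?_
  refine StronglyMeasurable.integral_prod_right (f := fun z y => p y * reflected D y z) ?_
  exact ((hp.comp measurable_snd).mul
    (hD.measurable_reflected.comp measurable_swap)).stronglyMeasurable

/-- Tonelli with the sub-Markov bound on the inner integral. This justifies exchanging integrals and
gives the integrability of `reflectedConv`. -/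
lemma integrable_mul_reflected {p : ℝ → ℝ} (hp : IntegrableOn p (Ioi 0)) :
    Integrable (fun q : ℝ × ℝ => p q.1 * reflected D q.1 q.2)
      ((volume.restrict (Ioi 0)).prod (volume.restrict (Ioi 0))) := by
  have hm : AEStronglyMeasurable (fun q : ℝ × ℝ => p q.1 * reflected D q.1 q.2)
      ((volume.restrict (Ioi 0)).prod (volume.restrict (Ioi 0))) :=
    (hp.aestronglyMeasurable.comp_fst).mul hD.measurable_reflected.aestronglyMeasurable
  rw [integrable_prod_iff hm]
  refine ⟨ae_of_all _ fun y =>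
    ((hD.integrable_reflected y).integrableOn (s := Ioi 0)).const_mul (p y), ?_⟩
  refine hp.abs.mono' hm.norm.integral_prod_right' ?_
  filter_upwards [ae_restrict_mem measurableSet_Ioi] with y hy
  rw [Real.norm_of_nonneg (integral_nonneg fun _ => norm_nonneg _)]
  have : ∫ z in Ioi 0, ‖p y * reflected D y z‖ = |p y| * ∫ z in Ioi 0, reflected D y z := by
    rw [← integral_const_mul]
    refine setIntegral_congr_fun measurableSet_Ioi fun z hz => ?_
    rw [norm_mul, Real.norm_of_nonneg (hD.reflected_nonneg (le_of_lt hy) (le_of_lt hz)),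
      Real.norm_eq_abs]
  rw [this]
  exact mul_le_of_le_one_right (abs_nonneg _) (hD.integral_reflected_le y)

lemma integral_reflectedConv_mul {p b : ℝ → ℝ} (hp : IntegrableOn p (Ioi 0)) (hb : Measurable b)
    (hb1 : ∀ z, |b z| ≤ 1) :
    ∫ z in Ioi 0, reflectedConv D p z * b z =
      ∫ y in Ioi 0, p y * ∫ z in Ioi 0, reflected D y z * b z := by
  have h := (hD.integrable_mul_reflected hp).mul_bdd (c := 1) (g := fun q => b q.2)
    (hb.comp measurable_snd).aestronglyMeasurable (ae_of_all _ fun q => hb1 q.2)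
  have := integral_integral_swap (f := fun y z => p y * reflected D y z * b z) h
  unfold reflectedConv
  simp_rw [← integral_mul_const, ← integral_const_mul, ← mul_assoc]
  exact this.symm

/-- By symmetry the kernel is sub-Markov in each variable, so it preserves both the sup bound and
integrability. -/
lemma isBddDensity_reflectedConv {p : ℝ → ℝ} (hp : IsBddDensity p) :
    IsBddDensity (reflectedConv D p) := by
  refine ⟨hD.measurable_reflectedConv hp.measurable, fun z hz => ?_, ?_, ?_⟩
  · exact setIntegral_nonneg measurableSet_Ioi fun y hy =>
      mul_nonneg (hp.nonneg y hy) (hD.reflected_nonneg (le_of_lt hy) hz.le)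
  · obtain ⟨C, hC⟩ := hp.bdd
    have hC0 : 0 ≤ C := (hp.nonneg 1 one_pos).trans (hC 1 one_pos)
    refine ⟨C, fun z hz => ?_⟩
    calc reflectedConv D p z ≤ ∫ y in Ioi 0, C * reflected D z y := by
          refine integral_mono_of_nonneg ?_ ((hD.integrable_reflected z).integrableOn.const_mul C) ?_
          · filter_upwards [ae_restrict_mem measurableSet_Ioi] with y hy
            exact mul_nonneg (hp.nonneg y hy) (hD.reflected_nonneg (le_of_lt hy) hz.le)
          · filter_upwards [ae_restrict_mem measurableSet_Ioi] with y hy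
            rw [hD.reflected_comm z y]
            exact mul_le_mul_of_nonneg_right (hC y hy) (hD.reflected_nonneg (le_of_lt hy) hz.le)
      _ ≤ C := by
          rw [integral_const_mul]
          exact mul_le_of_le_one_right hC0 (hD.integral_reflected_le z)
  · exact (hD.integrable_mul_reflected hp.integrable).integral_prod_right

/-- Fubini moves the kernel onto the sine, which is an eigenfunction. -/
lemma sineTransform_reflectedConv {p : ℝ → ℝ} (hp : IntegrableOn p (Ioi 0)) (x : ℝ) :
    sineTransform (reflectedConv D p) x = m x * sineTransform p x := by
  unfold sineTransform
  rw [hD.integral_reflectedConv_mul hp (by fun_prop) (fun z => Real.abs_sin_le_one _)]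
  simp_rw [hD.integral_reflected_mul_sin, mul_left_comm _ (m x)]
  rw [integral_const_mul]
  ring

/-- The companion rule, with the kernel outside the transform. Only `p` has to be integrable, not
its sine transform, because the kernel itself is integrable in the other variable. -/
lemma reflectedConv_sineTransform {p : ℝ → ℝ} (hp : IntegrableOn p (Ioi 0)) (x : ℝ) :
    reflectedConv D (sineTransform p) x = sineTransform (fun y => m y * p y) x := by
  unfold sineTransform reflectedConv
  have h1 : Integrable (fun q : ℝ × ℝ => p q.2 * reflected D x q.1)
      ((volume.restrict (Ioi 0)).prod (volume.restrict (Ioi 0))) := by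
    simpa [mul_comm] using
      ((hD.integrable_reflected x).integrableOn (s := Ioi 0)).mul_prod hp
  have h := h1.mul_bdd (c := 1) (g := fun q => Real.sin (q.1 * q.2))
    (by fun_prop) (ae_of_all _ fun q => Real.abs_sin_le_one _)
  have := integral_integral_swap (f := fun z y => p y * reflected D x z * Real.sin (z * y)) h
  have e1 : ∀ z, (√(2 / Real.pi) * ∫ y in Ioi 0, p y * Real.sin (z * y)) * reflected D z x =
      √(2 / Real.pi) * ∫ y in Ioi 0, p y * reflected D x z * Real.sin (z * y) := by
    intro z
    rw [mul_assoc, hD.reflected_comm z x, ← integral_mul_const]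
    congr 1
    exact integral_congr_ae (ae_of_all _ fun y => by ring)
  have e2 : ∀ y, ∫ z in Ioi 0, p y * reflected D x z * Real.sin (z * y) =
      m y * p y * Real.sin (x * y) := by
    intro y
    have h2 := hD.integral_reflected_mul_sin y x
    rw [mul_comm x y, mul_right_comm, ← h2, mul_comm, ← integral_const_mul]
    exact integral_congr_ae (ae_of_all _ fun z => by
      simp only [mul_comm z y]; ring)
  simp_rw [e1, integral_const_mul, this, e2]

end CosDensity

/-- Parseval for integrable functions: Fubini and the symmetry of sin(xy). -/
lemma integral_sineTransform_mul {v : ℝ → ℝ} {w : ℝ → ℂ} (hv : IntegrableOn v (Ioi 0))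
    (hw : IntegrableOn w (Ioi 0)) :
    ∫ x in Ioi 0, (sineTransform v x : ℂ) * w x = ∫ y in Ioi 0, (v y : ℂ) * sineIntegral w y := by
  have h1 : Integrable (fun q : ℝ × ℝ => w q.1 * (v q.2 : ℂ))
      ((volume.restrict (Ioi 0)).prod (volume.restrict (Ioi 0))) :=
    Integrable.mul_prod (f := w) (g := fun y => (v y : ℂ)) hw hv.ofReal
  have h := h1.mul_bdd (c := 1) (g := fun q => (Real.sin (q.1 * q.2) : ℂ))
    (by fun_prop) (ae_of_all _ fun q => by
      rw [Complex.norm_real]; exact Real.abs_sin_le_one _)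
  have := integral_integral_swap (f := fun x y => w x * (v y : ℂ) * (Real.sin (x * y) : ℂ)) h
  have e1 : ∀ x, (sineTransform v x : ℂ) * w x =
      (√(2 / Real.pi) : ℂ) * ∫ y in Ioi 0, w x * (v y : ℂ) * (Real.sin (x * y) : ℂ) := by
    intro x
    simp_rw [mul_assoc, integral_const_mul]
    rw [sineTransform, Complex.ofReal_mul, ← integral_complex_ofReal]
    push_cast
    ring
  have e2 : ∀ y, (v y : ℂ) * sineIntegral w y =
      (√(2 / Real.pi) : ℂ) * ∫ x in Ioi 0, w x * (v y : ℂ) * (Real.sin (x * y) : ℂ) := by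
    intro y
    simp_rw [mul_comm (w _), mul_assoc, integral_const_mul]
    rw [sineIntegral]
    ring
  simp_rw [e1, e2, integral_const_mul]
  rw [this]

namespace IsBddDensity
variable {p : ℝ → ℝ} (hp : IsBddDensity p)
include hp

lemma mul_left {b : ℝ → ℝ} (hb : Measurable b) (hb0 : ∀ x, 0 ≤ b x)
    (hb1 : ∀ x, 0 < x → b x ≤ 1) : IsBddDensity fun x => b x * p x := by
  have hle : ∀ x, 0 < x → b x * p x ≤ p x := fun x hx =>
    mul_le_of_le_one_left (hp.nonneg x hx) (hb1 x hx)
  refine ⟨hb.mul hp.measurable, fun x hx => mul_nonneg (hb0 x) (hp.nonneg x hx), ?_, ?_⟩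
  · obtain ⟨C, hC⟩ := hp.bdd
    exact ⟨C, fun x hx => (hle x hx).trans (hC x hx)⟩
  · refine Integrable.mono' hp.integrable (hb.mul hp.measurable).aestronglyMeasurable ?_
    filter_upwards [ae_restrict_mem measurableSet_Ioi] with x hx
    rw [Real.norm_of_nonneg (mul_nonneg (hb0 x) (hp.nonneg x hx))]
    exact hle x hx

lemma memLp_two : MemLp (fun x => (p x : ℂ)) 2 halfLine := by
  obtain ⟨C, hC⟩ := hp.bdd
  have hm : AEStronglyMeasurable (fun x => (p x : ℂ)) halfLine :=
    (Complex.measurable_ofReal.comp hp.measurable).aestronglyMeasurable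
  rw [memLp_two_iff_integrable_sq_norm hm]
  refine Integrable.mono' (hp.integrable.const_mul C) (hm.norm.pow 2) ?_
  filter_upwards [ae_restrict_mem measurableSet_Ioi] with x hx
  have h0 := hp.nonneg x hx
  rw [Complex.norm_real, Real.norm_of_nonneg h0, Real.norm_of_nonneg (by positivity), sq]
  exact mul_le_mul_of_nonneg_right (hC x hx) h0

end IsBddDensity

/-! ### The sine transform of `y ↦ y exp (-c y²)` -/

lemma isBddDensity_mul_exp_neg_sq {c : ℝ} (hc : 0 < c) :
    IsBddDensity fun y => y * Real.exp (-(c * y ^ 2)) := by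
  refine ⟨by fun_prop, fun x hx => by positivity, ⟨1 + 1 / c, fun y hy => ?_⟩, ?_⟩
  -- The constant comes from exp(cy²) ≥ 1 + cy² and (1 + 1/c)(1 + cy²) ≥ 1 + y² ≥ y.
  · have h1 : y ≤ (1 + 1 / c) * Real.exp (c * y ^ 2) := by
      have h2 := Real.add_one_le_exp (c * y ^ 2)
      have h3 : (1 + 1 / c) * (c * y ^ 2 + 1) = c * y ^ 2 + 1 + y ^ 2 + 1 / c := by
        field_simp; ring
      have h4 : (1 + 1 / c) * (c * y ^ 2 + 1) ≤ (1 + 1 / c) * Real.exp (c * y ^ 2) := by gcongr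
      have h5 : 0 < 1 / c := by positivity
      nlinarith [sq_nonneg (y - 1), mul_pos hc (pow_pos hy 2)]
    rw [Real.exp_neg, ← div_eq_mul_inv, div_le_iff₀ (Real.exp_pos _)]
    exact h1
  · simpa using (integrable_mul_exp_neg_mul_sq hc).integrableOn

lemma integral_Ioi_exp_neg_sq_mul_cos {c : ℝ} (hc : 0 < c) (x : ℝ) :
    ∫ y in Ioi 0, Real.exp (-(c * y ^ 2)) * Real.cos (x * y) =
      √(Real.pi / c) * Real.exp (-(x ^ 2) / (4 * c)) / 2 := by
  have h := integral_comp_abs (f := fun y => Real.exp (-(c * y ^ 2)) * Real.cos (x * y))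
  have e : ∀ y : ℝ, Real.cos (x * |y|) = Real.cos (x * y) := fun y => by
    rcases abs_choice y with h | h <;> simp [h]
  simp only [sq_abs, e] at h
  rw [integral_exp_neg_sq_mul_cos hc] at h
  linarith

/-- Integration by parts with primitive -exp(-cy²) sin(xy)/(2c), which vanishes at 0 and at
infinity, reduces this to the cosine transform of the Gaussian. -/
lemma integral_mul_exp_neg_sq_mul_sin {c : ℝ} (hc : 0 < c) (x : ℝ) :
    ∫ y in Ioi 0, y * Real.exp (-(c * y ^ 2)) * Real.sin (x * y) =
      x / (4 * c) * √(Real.pi / c) * Real.exp (-(x ^ 2) / (4 * c)) := by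
  have i1 : IntegrableOn (fun y => y * Real.exp (-(c * y ^ 2)) * Real.sin (x * y)) (Ioi 0) :=
    (isBddDensity_mul_exp_neg_sq hc).integrable.mul_bdd (c := 1) (by fun_prop)
      (ae_of_all _ fun z => Real.abs_sin_le_one _)
  have i2 : IntegrableOn (fun y => Real.exp (-(c * y ^ 2)) * Real.cos (x * y)) (Ioi 0) :=
    (integrable_exp_neg_sq hc).integrableOn.mul_bdd (c := 1) (by fun_prop)
      (ae_of_all _ fun z => Real.abs_cos_le_one _)
  have hd : ∀ y : ℝ, HasDerivAt (fun y => -(Real.exp (-(c * y ^ 2)) * Real.sin (x * y)) / (2 * c))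
      (y * Real.exp (-(c * y ^ 2)) * Real.sin (x * y) -
        x / (2 * c) * (Real.exp (-(c * y ^ 2)) * Real.cos (x * y))) y := by
    intro y
    have h1 : HasDerivAt (fun y : ℝ => Real.exp (-(c * y ^ 2)))
        (Real.exp (-(c * y ^ 2)) * -(c * (2 * y))) y := by
      have := ((((hasDerivAt_pow 2 y).const_mul c).neg).exp)
      simpa using this
    have h2 : HasDerivAt (fun y : ℝ => Real.sin (x * y)) (Real.cos (x * y) * x) y := by
      simpa using ((hasDerivAt_id y).const_mul x).sin
    refine (((h1.mul h2).neg).div_const (2 * c)).congr_deriv ?_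
    field_simp
    ring
  have ht : Tendsto (fun y => -(Real.exp (-(c * y ^ 2)) * Real.sin (x * y)) / (2 * c)) atTop
      (𝓝 0) := by
    have h0 : Tendsto (fun y : ℝ => Real.exp (-(c * y ^ 2))) atTop (𝓝 0) :=
      Real.tendsto_exp_neg_atTop_nhds_zero.comp
        ((tendsto_pow_atTop two_ne_zero).const_mul_atTop hc)
    have h1 := h0.zero_mul_isBoundedUnder_le (g := fun y => Real.sin (x * y))
      (isBoundedUnder_of ⟨1, fun y => Real.abs_sin_le_one _⟩)
    simpa using (h1.neg).div_const (2 * c)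
  have h := integral_Ioi_of_hasDerivAt_of_tendsto (a := 0)
    (hd 0).continuousAt.continuousWithinAt (fun y _ => hd y) (i1.sub (i2.const_mul _)) ht
  rw [integral_sub i1 (i2.const_mul _), integral_const_mul, integral_Ioi_exp_neg_sq_mul_cos hc] at h
  simp at h
  rw [sub_eq_zero.1 h]
  field_simp
  ring

lemma h_eq {s : ℝ} (x : ℝ) :
    h s x = 1 / √(2 * Real.pi * (1 - s) ^ 3) * (x * Real.exp (-(1 / (2 * (1 - s)) * x ^ 2))) := by
  unfold h
  rw [show -x ^ 2 / (2 * (1 - s)) = -(1 / (2 * (1 - s)) * x ^ 2) by ring]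
  ring

lemma h_pos {s x : ℝ} (hs : s < 1) (hx : 0 < x) : 0 < h s x := by
  have : 0 < 1 - s := by linarith
  unfold h; positivity

lemma measurable_h (s : ℝ) : Measurable (h s) := by unfold h; fun_prop

lemma IsBddDensity.const_mul {p : ℝ → ℝ} (hp : IsBddDensity p) {c : ℝ} (hc : 0 ≤ c) :
    IsBddDensity fun x => c * p x := by
  obtain ⟨C, hC⟩ := hp.bdd
  exact ⟨hp.measurable.const_mul c, fun x hx => mul_nonneg hc (hp.nonneg x hx),
    ⟨c * C, fun x hx => mul_le_mul_of_nonneg_left (hC x hx) hc⟩, hp.integrable.const_mul c⟩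

lemma isBddDensity_h {s : ℝ} (hs : s < 1) : IsBddDensity (h s) := by
  have : 0 < 1 - s := by linarith
  rw [funext h_eq]
  exact (isBddDensity_mul_exp_neg_sq (c := 1 / (2 * (1 - s))) (by positivity)).const_mul
    (by positivity)

lemma sqrt_mul_cube {c : ℝ} (hc : 0 < c) : √(2 * Real.pi * c ^ 3) = √(2 * Real.pi) * (c * √c) := by
  rw [Real.sqrt_mul (by positivity), show c ^ 3 = c ^ 2 * c by ring,
    Real.sqrt_mul (x := c ^ 2) (by positivity), Real.sqrt_sq hc.le]

/-- Divided by y, this is the function g that corresponds to f = 1. -/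
lemma sineTransform_h {s : ℝ} (hs : s < 1) (y : ℝ) :
    sineTransform (h s) y = 1 / √(2 * Real.pi) * (y * Real.exp (-((1 - s) * y ^ 2 / 2))) := by
  have h1 : 0 < 1 - s := by linarith
  generalize hc : 1 - s = c at *
  unfold sineTransform
  simp_rw [h_eq, hc]
  simp_rw [mul_assoc (1 / √(2 * Real.pi * c ^ 3))]
  rw [integral_const_mul, integral_mul_exp_neg_sq_mul_sin (by positivity), sqrt_mul_cube h1,
    show Real.pi / (1 / (2 * c)) = 2 * Real.pi * c by field_simp,
    Real.sqrt_mul (x := 2 * Real.pi) (by positivity),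
    show 2 / Real.pi = 2 ^ 2 / (2 * Real.pi) by field_simp, Real.sqrt_div (by positivity),
    Real.sqrt_sq (by positivity), show -(y ^ 2) / (4 * (1 / (2 * c))) = -(c * y ^ 2 / 2) by
      field_simp; ring]
  have : 0 < √c := by positivity
  field_simp
  ring

/-- Base case of the duality: the factor of the entrance density other than h_s is the transform of
2y exp(-sy²/2). The 2 and one of the two factors y in the final formula arise here. -/
lemma sineTransform_mul_exp_neg_sq {s : ℝ} (hs : 0 < s) (x : ℝ) :
    sineTransform (fun y => 2 * (y * Real.exp (-(s * y ^ 2 / 2)))) x =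
      √(8 * Real.pi) * h (1 - s) x := by
  unfold sineTransform
  simp_rw [mul_assoc (2 : ℝ)]
  rw [integral_const_mul]
  have := integral_mul_exp_neg_sq_mul_sin (c := s / 2) (by positivity) x
  simp_rw [show ∀ y : ℝ, s * y ^ 2 / 2 = s / 2 * y ^ 2 from fun y => by ring]
  rw [this, h, show 1 - (1 - s) = s by ring, sqrt_mul_cube hs,
    show 8 * Real.pi = 2 ^ 2 * (2 * Real.pi) by ring, Real.sqrt_mul (x := 2 ^ 2) (by positivity),
    Real.sqrt_sq (by positivity), Real.sqrt_div (by positivity), Real.sqrt_div (by positivity),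
    Real.sqrt_div (by positivity), Real.sqrt_mul (by positivity),
    show -(x ^ 2) / (4 * (s / 2)) = -(x ^ 2) / (2 * s) by ring]
  have h2 := Real.sq_sqrt (show (0 : ℝ) ≤ 2 by norm_num)
  have : 0 < √s := by positivity
  field_simp
  rw [h2]
  ring

/-! ### The two dual recursions -/

/-- The density of the radial Cauchy chain weighted by the squared radii. -/
def radialPart (s₀ : ℝ) (a b : ℕ → ℝ) : ℕ → ℝ → ℝ
  | 0 => fun y => 2 * (y * Real.exp (-(s₀ * y ^ 2 / 2)))
  | k + 1 => fun z => Real.exp (-(b k * z ^ 2 / 2)) *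
      reflectedConv (cauchyDensity (a k)) (radialPart s₀ a b k) z

/-- The density of the killed Brownian chain weighted by the positions. -/
def killedPart (s₀ : ℝ) (a b : ℕ → ℝ) : ℕ → ℝ → ℝ
  | 0 => fun x => √(8 * Real.pi) * h (1 - s₀) x
  | k + 1 => reflectedConv (gaussianDensity (b k))
      fun x => Real.exp (-(a k * |x|)) * killedPart s₀ a b k x

section dual
variable {s₀ : ℝ} {a b : ℕ → ℝ} (hs : 0 < s₀) (ha : ∀ k, 0 < a k) (hb : ∀ k, 0 < b k)
include hs ha hb

lemma isBddDensity_radialPart (k : ℕ) : IsBddDensity (radialPart s₀ a b k) := by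
  induction k with
  | zero =>
    have := (isBddDensity_mul_exp_neg_sq (c := s₀ / 2) (by positivity)).const_mul zero_le_two
    simpa only [radialPart, div_mul_eq_mul_div] using this
  | succ k ih =>
    refine ((cosDensity_cauchy (ha k)).isBddDensity_reflectedConv ih).mul_left
      (b := fun z => Real.exp (-(b k * z ^ 2 / 2))) (by fun_prop) (fun x => by positivity)
      fun x hx => Real.exp_le_one_iff.2 ?_
    have := (hb k).le
    simp only [Left.neg_nonpos_iff]; positivity

omit hs hb in
lemma isBddDensity_exp_mul_killedPart {k : ℕ} (h : IsBddDensity (killedPart s₀ a b k)) :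
    IsBddDensity fun x => Real.exp (-(a k * |x|)) * killedPart s₀ a b k x := by
  refine h.mul_left (b := fun x => Real.exp (-(a k * |x|))) (by fun_prop) (fun x => by positivity)
    fun x hx => Real.exp_le_one_iff.2 ?_
  have := (ha k).le
  simp only [Left.neg_nonpos_iff]; positivity

lemma isBddDensity_killedPart (k : ℕ) : IsBddDensity (killedPart s₀ a b k) := by
  induction k with
  | zero => exact (isBddDensity_h (by linarith)).const_mul (by positivity)
  | succ k ih =>
    exact (cosDensity_gaussian (hb k)).isBddDensity_reflectedConv
      (isBddDensity_exp_mul_killedPart ha ih)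

/-- The weight exp(-a|x|) is the Cauchy multiplier, so it is absorbed into a reflected Cauchy
convolution under the transform. The Gaussian convolution that follows becomes multiplication by
exp(-by²/2) under the transform. Together they make one step of `radialPart`. -/
lemma killedPart_eq_sineTransform (k : ℕ) :
    killedPart s₀ a b k = sineTransform (radialPart s₀ a b k) := by
  induction k with
  | zero => exact funext fun x => (sineTransform_mul_exp_neg_sq hs x).symm
  | succ k ih =>
    have hv := (isBddDensity_radialPart hs ha hb k)
    have hD := cosDensity_cauchy (ha k)
    have e : (fun x => Real.exp (-(a k * |x|)) * killedPart s₀ a b k x) =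
        sineTransform (reflectedConv (cauchyDensity (a k)) (radialPart s₀ a b k)) :=
      funext fun x => by rw [hD.sineTransform_reflectedConv hv.integrable, ih]
    funext x
    rw [killedPart, e, (cosDensity_gaussian (hb k)).reflectedConv_sineTransform
      (hD.isBddDensity_reflectedConv hv).integrable]
    rfl

end dual

/-! ### The Parseval relation -/

/-- By Cauchy–Schwarz, L² convergence of one factor gives L¹ convergence of the product. -/
lemma tendsto_integral_mul_of_eLpNorm {α : Type*} [MeasurableSpace α] {ν : Measure α}
    {p w : α → ℂ} {φ : ℕ → α → ℂ} (hp : MemLp p 2 ν) (hw : MemLp w 2 ν)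
    (hφ : ∀ m, AEStronglyMeasurable (φ m) ν)
    (h : Tendsto (fun m => eLpNorm (fun x => φ m x - w x) 2 ν) atTop (𝓝 0)) :
    Tendsto (fun m => ∫ x, p x * φ m x ∂ν) atTop (𝓝 (∫ x, p x * w x ∂ν)) := by
  have key : ∀ m, eLpNorm (fun x => p x * φ m x - p x * w x) 1 ν ≤
      eLpNorm p 2 ν * eLpNorm (fun x => φ m x - w x) 2 ν := by
    intro m
    have := eLpNorm_smul_le_mul_eLpNorm (p := 2) (q := 2) (r := 1)
      ((hφ m).sub hw.aestronglyMeasurable) hp.aestronglyMeasurable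
    refine (le_of_eq ?_).trans this
    congr 1
    funext x
    simp [mul_sub]
  have hlim : Tendsto (fun m => eLpNorm p 2 ν * eLpNorm (fun x => φ m x - w x) 2 ν) atTop (𝓝 0) := by
    simpa using ENNReal.Tendsto.const_mul h (Or.inr hp.eLpNorm_ne_top)
  -- No `φ m` is assumed square integrable; convergence makes the distance to `w` finite eventually,
  -- which suffices.
  have hfin : ∀ᶠ m in atTop, eLpNorm (fun x => φ m x - w x) 2 ν < ⊤ :=
    h.eventually (gt_mem_nhds ENNReal.zero_lt_top)
  refine tendsto_integral_of_L1' _ (hp.aestronglyMeasurable.mul hw.aestronglyMeasurable) ?_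
    (tendsto_of_tendsto_of_tendsto_of_le_of_le tendsto_const_nhds hlim (fun _ => zero_le) key)
  filter_upwards [hfin] with m hm
  have hd : MemLp (fun x => φ m x - w x) 2 ν := ⟨(hφ m).sub hw.aestronglyMeasurable, hm⟩
  have := hd.add hw
  refine hp.integrable_mul (this.congr_norm (hφ m) (ae_of_all _ fun x => ?_))
  simp

lemma continuous_sineIntegral {φ : ℝ → ℂ} (hφ : IntegrableOn φ (Ioi 0)) :
    Continuous (sineIntegral φ) := by
  refine continuous_const.mul (continuous_of_dominated (bound := fun x => ‖φ x‖)
    (fun y => hφ.aestronglyMeasurable.mul (by fun_prop)) (fun y => ae_of_all _ fun x => ?_) hφ.norm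
    (ae_of_all _ fun x => by fun_prop))
  rw [norm_mul, Complex.norm_real]
  exact mul_le_of_le_one_right (norm_nonneg _) (Real.abs_sin_le_one _)

/-- The L¹ identity holds for the approximating test functions. Both sides pass to the limit because
`p` and its sine transform are in L². -/
lemma integral_sineTransform_mul_of_isFourierSineTransform {p : ℝ → ℝ} {w w' : ℝ → ℂ}
    (hp : IsBddDensity p) (hp' : IsBddDensity (sineTransform p))
    (hw : IsFourierSineTransform w w') :
    ∫ x in Ioi 0, (sineTransform p x : ℂ) * w x = ∫ y in Ioi 0, (p y : ℂ) * w' y := by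
  obtain ⟨hw1, hw2, φ, hφ, l1, l2⟩ := hw
  have hi : ∀ m, Integrable (φ m) := fun m =>
    (hφ m).1.continuous.integrable_of_hasCompactSupport (hφ m).2.1
  have t1 := tendsto_integral_mul_of_eLpNorm hp'.memLp_two hw1
    (fun m => (hi m).aestronglyMeasurable.restrict) l1
  have t2 := tendsto_integral_mul_of_eLpNorm hp.memLp_two hw2
    (fun m => (continuous_sineIntegral (hi m).integrableOn).aestronglyMeasurable) l2
  refine tendsto_nhds_unique t1 (t2.congr fun m => ?_)
  exact (integral_sineTransform_mul hp.integrable (hi m).integrableOn).symm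

/-! ### Marginals of chains with a transition density -/

/-- The density of the last coordinate of a chain with initial density `A` and transition
densities `K k`. -/
def chainDensity (A : ℝ → ℝ≥0∞) (K : ℕ → ℝ → ℝ → ℝ≥0∞) : ℕ → ℝ → ℝ≥0∞
  | 0 => A
  | k + 1 => fun z => ∫⁻ y, chainDensity A K k y * K k y z

section chain
variable {A : ℝ → ℝ≥0∞} {K : ℕ → ℝ → ℝ → ℝ≥0∞} (hA : Measurable A)
  (hK : ∀ k, Measurable (Function.uncurry (K k)))
include hA hK

lemma measurable_chainDensity (n : ℕ) : Measurable (chainDensity A K n) := by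
  induction n with
  | zero => exact hA
  | succ n ih =>
    refine Measurable.lintegral_prod_right (f := fun z y => chainDensity A K n y * K n y z) ?_
    exact (ih.comp measurable_snd).mul ((hK n).comp measurable_swap)

/-- Induction on the length: integrating out the last coordinate replaces `F` by its image under the
last transition, so `F` must stay general. Tonelli then moves that transition back onto the density.
-/
lemma lintegral_chain (n : ℕ) {F : ℝ → ℝ≥0∞} (hF : Measurable F) :
    ∫⁻ x : Fin (n + 1) → ℝ, A (x 0) * (∏ k : Fin n, K k (x k.castSucc) (x k.succ)) *
      F (x (Fin.last n)) = ∫⁻ y, chainDensity A K n y * F y := by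
  have hK' : ∀ (k : ℕ) {α : Type} [MeasurableSpace α] {f g : α → ℝ}, Measurable f → Measurable g →
      Measurable fun x => K k (f x) (g x) := fun k _ _ f g hf hg => (hK k).comp (hf.prodMk hg)
  have hm : ∀ n, Measurable fun x : Fin (n + 1) → ℝ =>
      A (x 0) * (∏ k : Fin n, K k (x k.castSucc) (x k.succ)) := fun n =>
    (hA.comp (measurable_pi_apply 0)).mul (Finset.measurable_prod _ fun k _ =>
      hK' _ (measurable_pi_apply _) (measurable_pi_apply _))
  induction n generalizing F with
  | zero =>
    have e := (volume_preserving_funUnique (Fin 1) ℝ).lintegral_comp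
      (f := fun y => A y * F y) (hA.mul hF)
    rw [chainDensity, ← e]
    simp
    rfl
  | succ n ih =>
    have e := (volume_preserving_piFinSuccAbove (fun _ : Fin (n + 2) => ℝ) (Fin.last (n + 1))).symm
    rw [← e.lintegral_comp (f := fun x => A (x 0) * (∏ k : Fin (n + 1), K k (x k.castSucc) (x k.succ)) *
      F (x (Fin.last (n + 1)))) ((hm _).mul (hF.comp (measurable_pi_apply _)))]
    have hk : ∀ p : ℝ × (Fin (n + 1) → ℝ),
        (MeasurableEquiv.piFinSuccAbove (fun _ : Fin (n + 2) => ℝ) (Fin.last (n + 1))).symm p =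
          Fin.snoc (α := fun _ => ℝ) p.2 p.1 := fun p => Fin.insertNth_last' p.1 p.2
    simp_rw [hk, Fin.prod_univ_castSucc, Fin.succ_last, Fin.snoc_last, Fin.succ_castSucc,
      Fin.snoc_castSucc, ← Fin.castSucc_zero, Fin.snoc_castSucc]
    simp only [Fin.val_castSucc, Fin.val_last]
    have hmeas : Measurable fun p : ℝ × (Fin (n + 1) → ℝ) =>
        A (p.2 0) * ((∏ k : Fin n, K k (p.2 k.castSucc) (p.2 k.succ)) *
          K n (p.2 (Fin.last n)) p.1) * F p.1 := by
      have : Measurable fun p : ℝ × (Fin (n + 1) → ℝ) => A (p.2 0) *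
          (∏ k : Fin n, K k (p.2 k.castSucc) (p.2 k.succ)) * K n (p.2 (Fin.last n)) p.1 :=
        ((hm n).comp (measurable_snd (α := ℝ))).mul
        (hK' n (f := fun p : ℝ × (Fin (n + 1) → ℝ) => p.2 (Fin.last n)) (g := Prod.fst)
          (by fun_prop) measurable_fst)
      simp_rw [← mul_assoc (A _)]
      exact this.mul (hF.comp measurable_fst)
    have hG : Measurable fun y => ∫⁻ z, K n y z * F z :=
      Measurable.lintegral_prod_right (f := fun y z => K n y z * F z)
        ((hK n).mul (hF.comp measurable_snd))
    rw [Measure.volume_eq_prod, lintegral_prod_symm' _ hmeas]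
    have e1 : ∀ x : Fin (n + 1) → ℝ, ∫⁻ z, A (x 0) *
        ((∏ k : Fin n, K k (x k.castSucc) (x k.succ)) * K n (x (Fin.last n)) z) * F z =
        A (x 0) * (∏ k : Fin n, K k (x k.castSucc) (x k.succ)) *
          ∫⁻ z, K n (x (Fin.last n)) z * F z := by
      intro x
      rw [← lintegral_const_mul]
      · simp_rw [mul_assoc]
      · exact (hK' n measurable_const measurable_id).mul hF
    simp_rw [e1]
    rw [ih hG]
    have e2 : ∀ y, chainDensity A K n y * ∫⁻ z, K n y z * F z =
        ∫⁻ z, chainDensity A K n y * K n y z * F z := by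
      intro y
      rw [← lintegral_const_mul]
      · simp_rw [mul_assoc]
      · exact (hK' n measurable_const measurable_id).mul hF
    simp_rw [e2]
    rw [lintegral_lintegral_swap]
    · refine lintegral_congr fun z => ?_
      rw [lintegral_mul_const]
      · rfl
      · exact (measurable_chainDensity hA hK n).mul (hK' n measurable_id measurable_const)
    · exact ((((measurable_chainDensity hA hK n).comp measurable_fst).mul (hK n)).mul
        (hF.comp measurable_snd)).aemeasurable

end chain

/-! ### The weighted law of the excursion -/

lemma CosDensity.integrableOn_mul_reflected {D m p : ℝ → ℝ} (hD : CosDensity D m)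
    (hp : IsBddDensity p) (z : ℝ) : IntegrableOn (fun y => p y * reflected D y z) (Ioi 0) := by
  obtain ⟨C, hC⟩ := hp.bdd
  simp_rw [hD.reflected_comm _ z]
  refine (hD.integrable_reflected z).integrableOn.bdd_mul (c := C)
    hp.measurable.aestronglyMeasurable ?_
  filter_upwards [ae_restrict_mem measurableSet_Ioi] with y hy
  rw [Real.norm_of_nonneg (hp.nonneg y hy)]
  exact hC y hy

lemma CosDensity.ofReal_reflectedConv {D m p : ℝ → ℝ} (hD : CosDensity D m)
    (hp : IsBddDensity p) {z : ℝ} (hz : 0 < z) :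
    ENNReal.ofReal (reflectedConv D p z) =
      ∫⁻ y in Ioi 0, ENNReal.ofReal (p y * reflected D y z) := by
  refine ofReal_integral_eq_lintegral_ofReal (hD.integrableOn_mul_reflected hp z) ?_
  filter_upwards [ae_restrict_mem measurableSet_Ioi] with y hy
  exact mul_nonneg (hp.nonneg y hy) (hD.reflected_nonneg (le_of_lt hy) hz.le)

lemma measurable_excursionDensity (s₁ s₂ : ℝ) :
    Measurable (Function.uncurry (excursionDensity s₁ s₂)) := by
  have h1 := measurable_h s₁
  have h2 := measurable_h s₂
  have h3 := measurable_h (1 - s₂)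
  unfold Function.uncurry excursionDensity killedKernel
  refine Measurable.ite ?_ (by fun_prop) (Measurable.ite ?_ (by fun_prop) (by fun_prop))
  · exact (MeasurableSet.const (s₁ = 0)).inter ((measurableSet_eq_fun measurable_fst
      measurable_const).inter (measurableSet_lt measurable_const measurable_snd))
  · exact (MeasurableSet.const (0 < s₁)).inter ((measurableSet_lt measurable_const
      measurable_fst).inter (measurableSet_lt measurable_const measurable_snd))

lemma excursionDensity_zero {s x : ℝ} (hx : 0 < x) :
    excursionDensity 0 s 0 x = √(8 * Real.pi) * h s x * h (1 - s) x := by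
  simp [excursionDensity, hx]

lemma excursionDensity_pos {s₁ s₂ x₁ x₂ : ℝ} (hs : 0 < s₁) (hx₁ : 0 < x₁) (hx₂ : 0 < x₂) :
    excursionDensity s₁ s₂ x₁ x₂ =
      h s₂ x₂ / h s₁ x₁ * reflected (gaussianDensity (s₂ - s₁)) x₁ x₂ := by
  simp [excursionDensity, hs, hx₁, hx₂, hs.ne', killedKernel_eq_reflected]

lemma excursionDensity_of_nonpos {s₁ s₂ x₁ x₂ : ℝ} (hx : x₂ ≤ 0) :
    excursionDensity s₁ s₂ x₁ x₂ = 0 := by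
  simp [excursionDensity, hx.not_gt]

lemma excursionDensity_nonneg {s₁ s₂ : ℝ} (h12 : s₁ < s₂) (h2 : s₂ < 1) (h0 : 0 < s₂) (x₁ x₂ : ℝ) :
    0 ≤ excursionDensity s₁ s₂ x₁ x₂ := by
  unfold excursionDensity
  split_ifs with hc hc'
  · have := h_pos h2 hc.2.2
    have := h_pos (s := 1 - s₂) (by linarith) hc.2.2
    positivity
  · have := h_pos h2 hc'.2.2
    have := h_pos (h12.trans h2) hc'.2.1
    rw [killedKernel_eq_reflected]
    exact mul_nonneg (by positivity)
      ((cosDensity_gaussian (sub_pos.2 h12)).reflected_nonneg hc'.2.1.le hc'.2.2.le)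
  · exact le_rfl

/-- The transition densities of the excursion weighted by the positions. -/
def weightedExcursion (S a : ℕ → ℝ) (k : ℕ) (x y : ℝ) : ℝ≥0∞ :=
  ENNReal.ofReal (Real.exp (-(a k * x)) * excursionDensity (S k) (S (k + 1)) x y)

lemma measurable_weightedExcursion (S a : ℕ → ℝ) (k : ℕ) :
    Measurable (Function.uncurry (weightedExcursion S a k)) := by
  have := measurable_excursionDensity (S k) (S (k + 1))
  unfold Function.uncurry weightedExcursion at *
  fun_prop

section excursion
variable {S a : ℕ → ℝ} (hS : StrictMono S) (hS0 : 0 < S 0) (ha : ∀ k, 0 < a k)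
include hS hS0 ha

/-- The numerator of each h-quotient cancels the denominator of the next, leaving only the last h.
The indicator records that the excursion densities are carried by positive positions. -/
lemma chainDensity_excursion (k : ℕ) (hk : S k < 1) :
    chainDensity (fun x => ENNReal.ofReal (excursionDensity 0 (S 0) 0 x)) (weightedExcursion S a) k =
      (Ioi 0).indicator fun x => ENNReal.ofReal
        (h (S k) x * killedPart (S 0) a (fun j => S (j + 1) - S j) k x) := by
  induction k with
  | zero =>
    funext x
    rcases lt_or_ge 0 x with hx | hx
    · rw [indicator_of_mem (mem_Ioi.2 hx), chainDensity, excursionDensity_zero hx, killedPart]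
      congr 1; ring
    · rw [indicator_of_notMem (by simpa using hx), chainDensity, excursionDensity_of_nonpos hx,
        ENNReal.ofReal_zero]
  | succ k ih =>
    have hk' : S k < 1 := (hS k.lt_succ_self).trans hk
    have hSk : 0 < S k := hS0.trans_le (hS.monotone k.zero_le)
    have hb : ∀ k, 0 < S (k + 1) - S k := fun k => sub_pos.2 (hS k.lt_succ_self)
    have hu := isBddDensity_killedPart hS0 ha hb k
    funext z
    rw [chainDensity, ih hk']
    simp_rw [← indicator_mul_left (Ioi (0 : ℝ)) _ fun y => weightedExcursion S a k y z]
    rw [lintegral_indicator measurableSet_Ioi]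
    rcases lt_or_ge 0 z with hz | hz
    · have hh := h_pos hk hz
      rw [indicator_of_mem (mem_Ioi.2 hz), killedPart, ENNReal.ofReal_mul hh.le,
        (cosDensity_gaussian (hb k)).ofReal_reflectedConv
          (isBddDensity_exp_mul_killedPart ha hu) hz, ← lintegral_const_mul']
      · refine setLIntegral_congr_fun measurableSet_Ioi fun y hy => ?_
        have hy0 : 0 < h (S k) y := h_pos hk' hy
        simp only [weightedExcursion]
        rw [excursionDensity_pos hSk hy hz, ← ENNReal.ofReal_mul hh.le,
          ← ENNReal.ofReal_mul (mul_nonneg hy0.le (hu.nonneg y hy)), abs_of_pos hy]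
        congr 1
        field_simp
      · exact ENNReal.ofReal_ne_top
    · rw [indicator_of_notMem (by simpa using hz)]
      simp [weightedExcursion, excursionDensity_of_nonpos hz]

/-- The exponential of the sum factors over the transitions, each factor depending on the position
before its jump; the last marginal of that weighted chain is already known. -/
lemma IsBrownianExcursion.map_withDensity {Ω : Type*} [MeasurableSpace Ω] {μ : Measure Ω}
    {B : unitInterval → Ω → ℝ} (hB : IsBrownianExcursion B μ) {n : ℕ}
    {s : Fin (n + 1) → unitInterval} (hs : ∀ k, (s k : ℝ) = S k) (hSn : S n < 1) :
    (μ.withDensity fun ω => ENNReal.ofReal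
        (Real.exp (-∑ k : Fin n, a k * B (s k.castSucc) ω))).map (B (s (Fin.last n))) =
      halfLine.withDensity fun x => ENNReal.ofReal
        (h (S n) x * killedPart (S 0) a (fun j => S (j + 1) - S j) n x) := by
  have hmono : StrictMono s := fun i j hij => Subtype.coe_lt_coe.1 (by
    rw [hs, hs]; exact hS hij)
  have hSp : ∀ k, 0 < S k := fun k => hS0.trans_le (hS.monotone k.zero_le)
  have hlt : ∀ k ≤ n, S k < 1 := fun k hk => (hS.monotone hk).trans_lt hSn
  have hlaw := hB.finite_dim n s hmono (by
      rw [← Subtype.coe_lt_coe, hs]; simpa using hS0) (by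
      rw [← Subtype.coe_lt_coe, hs]; simpa using hSn)
  have hA : Measurable fun x => ENNReal.ofReal (excursionDensity 0 (S 0) 0 x) :=
    ((measurable_excursionDensity 0 (S 0)).comp measurable_prodMk_left).ennreal_ofReal
  have hw : Measurable fun x : Fin (n + 1) → ℝ =>
      ENNReal.ofReal (Real.exp (-∑ k : Fin n, a k * x k.castSucc)) := by fun_prop
  have hd := chainDensity_excursion hS hS0 ha n hSn
  ext E hE
  rw [Measure.map_apply (hB.measurable _) hE, withDensity_apply _ (hB.measurable _ hE),
    withDensity_apply _ hE, halfLine, Measure.restrict_restrict hE,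
    ← setLIntegral_indicator hE, ← lintegral_indicator measurableSet_Ioi,
    ← lintegral_indicator (hB.measurable _ hE)]
  have e1 : ∫⁻ ω, (B (s (Fin.last n)) ⁻¹' E).indicator (fun ω => ENNReal.ofReal
        (Real.exp (-∑ k : Fin n, a k * B (s k.castSucc) ω))) ω ∂μ =
      ∫⁻ ω, (fun x : Fin (n + 1) → ℝ =>
        ENNReal.ofReal (Real.exp (-∑ k : Fin n, a k * x k.castSucc)) *
          E.indicator 1 (x (Fin.last n))) (fun i => B (s i) ω) ∂μ := by
    refine lintegral_congr fun ω => ?_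
    by_cases hω : B (s (Fin.last n)) ω ∈ E <;> simp [hω, indicator]
  have hE' : Measurable (E.indicator (1 : ℝ → ℝ≥0∞)) := measurable_one.indicator hE
  rw [e1, hlaw.lintegral_comp (f := fun x : Fin (n + 1) → ℝ =>
      ENNReal.ofReal (Real.exp (-∑ k : Fin n, a k * x k.castSucc)) *
        E.indicator 1 (x (Fin.last n))) (by fun_prop), lintegral_withDensity_eq_lintegral_mul₀]
  · have := lintegral_chain hA (measurable_weightedExcursion S a) n hE'
    rw [hd] at this
    refine (lintegral_congr fun x => ?_).trans (this.trans (lintegral_congr fun y => ?_))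
    · simp only [Pi.mul_apply, hs, weightedExcursion, Fin.coe_ofNat_eq_mod, Nat.zero_mod,
        Fin.val_castSucc, Fin.val_succ]
      rw [← mul_assoc]
      congr 1
      rw [ENNReal.ofReal_mul (excursionDensity_nonneg hS0 (hlt _ (Nat.zero_le _)) hS0 _ _), mul_assoc]
      congr 1
      rw [← ENNReal.ofReal_prod_of_nonneg fun k _ => mul_nonneg (Real.exp_nonneg _)
          (excursionDensity_nonneg (hS k.val.lt_succ_self) (hlt _ k.2) (hSp _) _ _),
        ← ENNReal.ofReal_mul (Finset.prod_nonneg fun k _ =>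
          excursionDensity_nonneg (hS k.val.lt_succ_self) (hlt _ k.2) (hSp _) _ _),
        Finset.prod_mul_distrib, ← Real.exp_sum, mul_comm]
      simp
    · by_cases hy : y ∈ E <;> by_cases hy0 : y ∈ Ioi (0 : ℝ) <;> simp [hy, hy0, indicator]
  · have hex : ∀ (s₁ s₂ : ℝ) {f g : (Fin (n + 1) → ℝ) → ℝ}, Measurable f → Measurable g →
        Measurable fun x => excursionDensity s₁ s₂ (f x) (g x) := fun s₁ s₂ f g hf hg =>
      (measurable_excursionDensity s₁ s₂).comp (hf.prodMk hg)
    exact ((hex _ _ measurable_const (measurable_pi_apply _)).mul (Finset.measurable_prod _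
      fun k _ => hex _ _ (measurable_pi_apply _)
        (measurable_pi_apply _))).ennreal_ofReal.aemeasurable
  · fun_prop

end excursion

/-! ### The radial part of the Cauchy distribution -/

lemma lintegral_euclideanSpace_three {F : ℝ × ℝ × ℝ → ℝ≥0∞} (hF : Measurable F) :
    ∫⁻ w : EuclideanSpace ℝ (Fin 3), F (w 0, w 1, w 2) = ∫⁻ x, ∫⁻ p : ℝ × ℝ, F (x, p) := by
  have e1 := EuclideanSpace.volume_preserving_symm_measurableEquiv_toLp (Fin 3)
  have e2 := volume_preserving_piFinSuccAbove (fun _ : Fin 3 => ℝ) 0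
  have e3 := (MeasurePreserving.id (volume : Measure ℝ)).prod
    (volume_preserving_piFinTwo (fun _ : Fin 2 => ℝ))
  have e := (e3.comp (e2.comp e1)).lintegral_comp hF
  have hv := lintegral_prod (μ := (volume : Measure ℝ)) (ν := (volume : Measure (ℝ × ℝ))) F
    hF.aemeasurable
  rw [← hv, ← e]
  rfl

lemma lintegral_comp_sq_add_sq {f : ℝ → ℝ≥0∞} (hf : Measurable f) :
    ∫⁻ p : ℝ × ℝ, f (p.1 ^ 2 + p.2 ^ 2) =
      ENNReal.ofReal (2 * Real.pi) * ∫⁻ q in Ioi 0, ENNReal.ofReal q * f (q ^ 2) := by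
  rw [← lintegral_comp_polarCoord_symm, polarCoord_target]
  have : ∀ p : ℝ × ℝ, (polarCoord.symm p).1 ^ 2 + (polarCoord.symm p).2 ^ 2 = p.1 ^ 2 := by
    intro p
    simp only [polarCoord_symm_apply]
    linear_combination p.1 ^ 2 * Real.cos_sq_add_sin_sq p.2
  simp_rw [this, smul_eq_mul]
  rw [Measure.volume_eq_prod, ← Measure.prod_restrict, lintegral_prod _ (by fun_prop)]
  simp only [lintegral_const, Measure.restrict_apply_univ, Real.volume_Ioo]
  rw [lintegral_mul_const _ (by fun_prop), mul_comm]
  congr 2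
  ring

/-- Polar coordinates; the upper half-plane corresponds to angles in (0, π). -/
lemma lintegral_half_plane {F : ℝ × ℝ → ℝ≥0∞} (hF : Measurable F) :
    ∫⁻ x, ∫⁻ q in Ioi 0, F (x, q) =
      ∫⁻ ρ in Ioi 0, ∫⁻ θ in Ioo 0 Real.pi,
        ENNReal.ofReal ρ * F (ρ * Real.cos θ, ρ * Real.sin θ) := by
  have hs : MeasurableSet {p : ℝ × ℝ | 0 < p.2} := measurableSet_lt (by fun_prop) (by fun_prop)
  have e1 : ∫⁻ x, ∫⁻ q in Ioi 0, F (x, q) = ∫⁻ p : ℝ × ℝ, {p : ℝ × ℝ | 0 < p.2}.indicator F p := by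
    rw [Measure.volume_eq_prod, lintegral_prod _ (hF.indicator hs).aemeasurable]
    refine lintegral_congr fun x => ?_
    rw [← lintegral_indicator measurableSet_Ioi]
    rfl
  rw [e1, ← lintegral_comp_polarCoord_symm, polarCoord_target, Measure.volume_eq_prod,
    ← Measure.prod_restrict]
  have hsym : Measurable fun p : ℝ × ℝ => polarCoord.symm p :=
    continuous_polarCoord_symm.measurable
  rw [lintegral_prod]
  · refine setLIntegral_congr_fun measurableSet_Ioi fun ρ hρ => ?_
    have hI : Ioo 0 Real.pi = Ioi 0 ∩ Ioo (-Real.pi) Real.pi := by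
      ext θ
      simp only [mem_Ioo, mem_inter_iff, mem_Ioi]
      have := Real.pi_pos
      constructor
      · rintro ⟨h1, h2⟩; exact ⟨h1, by linarith, h2⟩
      · rintro ⟨h1, _, h2⟩; exact ⟨h1, h2⟩
    simp only [hI, ← setLIntegral_indicator (measurableSet_Ioi (a := (0 : ℝ)))]
    refine setLIntegral_congr_fun measurableSet_Ioo fun θ hθ => ?_
    simp only [polarCoord_symm_apply, smul_eq_mul]
    by_cases h0 : 0 < θ
    · have : 0 < ρ * Real.sin θ := mul_pos hρ (Real.sin_pos_of_pos_of_lt_pi h0 hθ.2)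
      simp [indicator, h0, this]
    · have : ¬ 0 < ρ * Real.sin θ := by
        refine not_lt.2 (mul_nonpos_of_nonneg_of_nonpos (le_of_lt hρ) ?_)
        exact Real.sin_nonpos_of_nonpos_of_neg_pi_le (not_lt.1 h0) hθ.1.le
      simp [indicator, h0, this]
  · exact ((by fun_prop : Measurable fun p : ℝ × ℝ => ENNReal.ofReal p.1).smul
      ((hF.indicator hs).comp hsym)).aemeasurable

/-- The integrand has an elementary primitive, because sin θ is up to a constant the derivative of
the bracket. At θ = 0 and π the bracket is t² + (r ∓ ρ)². -/
lemma lintegral_angle {t r ρ : ℝ} (ht : 0 < t) (hr : 0 < r) (hρ : 0 < ρ) :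
    ∫⁻ θ in Ioo 0 Real.pi, ENNReal.ofReal (Real.sin θ /
        (t ^ 2 + (r ^ 2 + ρ ^ 2 - 2 * r * ρ * Real.cos θ)) ^ 2) =
      ENNReal.ofReal ((1 / (t ^ 2 + (r - ρ) ^ 2) - 1 / (t ^ 2 + (r + ρ) ^ 2)) / (2 * r * ρ)) := by
  have hpos : ∀ θ, 0 < t ^ 2 + (r ^ 2 + ρ ^ 2 - 2 * r * ρ * Real.cos θ) := fun θ => by
    have h1 := Real.cos_le_one θ
    have h2 : 0 < 2 * r * ρ := by positivity
    nlinarith [sq_nonneg (r - ρ), pow_pos ht 2]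
  have hc : Continuous fun θ => Real.sin θ /
      (t ^ 2 + (r ^ 2 + ρ ^ 2 - 2 * r * ρ * Real.cos θ)) ^ 2 :=
    Real.continuous_sin.div (by fun_prop) fun θ => (pow_pos (hpos θ) 2).ne'
  have hd : ∀ θ, HasDerivAt (fun θ => -(1 / (t ^ 2 + (r ^ 2 + ρ ^ 2 - 2 * r * ρ * Real.cos θ))) /
      (2 * r * ρ)) (Real.sin θ / (t ^ 2 + (r ^ 2 + ρ ^ 2 - 2 * r * ρ * Real.cos θ)) ^ 2) θ := by
    intro θ
    have h1 : HasDerivAt (fun θ => t ^ 2 + (r ^ 2 + ρ ^ 2 - 2 * r * ρ * Real.cos θ))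
        (2 * r * ρ * Real.sin θ) θ := by
      have := (((Real.hasDerivAt_cos θ).const_mul (2 * r * ρ)).const_sub (r ^ 2 + ρ ^ 2)).const_add
        (t ^ 2)
      simpa using this
    have h2 := ((h1.inv (hpos θ).ne').neg.div_const (2 * r * ρ))
    simp only [one_div]
    refine h2.congr_deriv ?_
    have := (hpos θ).ne'
    field_simp
  have hint := intervalIntegral.integral_eq_sub_of_hasDerivAt (a := 0) (b := Real.pi)
    (fun θ _ => hd θ) (hc.intervalIntegrable _ _)
  rw [intervalIntegral.integral_of_le Real.pi_pos.le, integral_Ioc_eq_integral_Ioo] at hint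
  rw [← ofReal_integral_eq_lintegral_ofReal]
  · rw [hint, Real.cos_pi, Real.cos_zero]
    congr 1
    rw [show r ^ 2 + ρ ^ 2 - 2 * r * ρ * (-1) = (r + ρ) ^ 2 by ring,
      show r ^ 2 + ρ ^ 2 - 2 * r * ρ * 1 = (r - ρ) ^ 2 by ring]
    ring
  · exact (hc.continuousOn.integrableOn_Icc).mono_set Ioo_subset_Icc_self
  · filter_upwards [ae_restrict_mem measurableSet_Ioo] with θ hθ
    exact div_nonneg (Real.sin_pos_of_pos_of_lt_pi hθ.1 hθ.2).le (sq_nonneg _)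

/-- The transition density of the radial part of the Cauchy process. -/
def radialDensity (t r ρ : ℝ) : ℝ := ρ / r * reflected (cauchyDensity t) r ρ

lemma measurable_radialDensity {t : ℝ} (ht : 0 < t) :
    Measurable (Function.uncurry (radialDensity t)) :=
  (measurable_snd.div measurable_fst).mul (cosDensity_cauchy ht).measurable_reflected

/-- By rotation invariance z may be placed on the first axis. Polar coordinates in the orthogonal
plane, then in the half-plane (x, q), leave an explicit angular integral, whose value is a
difference of two one-dimensional Cauchy densities. -/
lemma lintegral_cauchyLaw {t : ℝ} (ht : 0 < t) {z : EuclideanSpace ℝ (Fin 3)} (hz : z ≠ 0)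
    {G : ℝ → ℝ≥0∞} (hG : Measurable G) :
    ∫⁻ ξ, G ‖z + ξ‖ ∂(cauchyLaw t) =
      ∫⁻ ρ in Ioi 0, ENNReal.ofReal (radialDensity t ‖z‖ ρ) * G ρ := by
  set r := ‖z‖ with hr
  have hr0 : 0 < r := norm_pos_iff.2 hz
  set c : ℝ → ℝ := fun x => t / (Real.pi ^ 2 * (t ^ 2 + x) ^ 2) with hc
  have hcm : Measurable c := by fun_prop
  set e : EuclideanSpace ℝ (Fin 3) := EuclideanSpace.single 0 r with he
  have hne : ‖z‖ = ‖e‖ := by simp [he, abs_of_pos hr0, ← hr]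
  -- As z and e have equal norm, reflection in the hyperplane orthogonal to z - e sends z to e.
  set L := (ℝ ∙ (z - e))ᗮ.reflection with hL
  have hLz : L z = e := Submodule.reflection_sub hne
  calc ∫⁻ ξ, G ‖z + ξ‖ ∂(cauchyLaw t)
      = ∫⁻ ξ, ENNReal.ofReal (c (‖ξ‖ ^ 2)) * G ‖z + ξ‖ := by
        rw [cauchyLaw, lintegral_withDensity_eq_lintegral_mul _ (by fun_prop) (by fun_prop)]
        rfl
    _ = ∫⁻ w, ENNReal.ofReal (c (‖w - z‖ ^ 2)) * G ‖w‖ := by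
        rw [← lintegral_add_left_eq_self (fun w => ENNReal.ofReal (c (‖w - z‖ ^ 2)) * G ‖w‖) z]
        simp
    _ = ∫⁻ w, ENNReal.ofReal (c (‖w - e‖ ^ 2)) * G ‖w‖ := by
        rw [← L.measurePreserving.lintegral_comp (f := fun w =>
          ENNReal.ofReal (c (‖w - e‖ ^ 2)) * G ‖w‖) (by fun_prop)]
        refine lintegral_congr fun w => ?_
        rw [← hLz, ← map_sub, L.norm_map, L.norm_map]
    _ = ∫⁻ w : EuclideanSpace ℝ (Fin 3), (fun p : ℝ × ℝ × ℝ =>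
          ENNReal.ofReal (c ((p.1 - r) ^ 2 + (p.2.1 ^ 2 + p.2.2 ^ 2))) *
            G √(p.1 ^ 2 + (p.2.1 ^ 2 + p.2.2 ^ 2))) (w 0, w 1, w 2) := by
        refine lintegral_congr fun w => ?_
        have h1 : ‖w - e‖ ^ 2 = (w 0 - r) ^ 2 + (w 1 ^ 2 + w 2 ^ 2) := by
          rw [EuclideanSpace.real_norm_sq_eq, Fin.sum_univ_three]
          simp [he]; ring
        have h2 : ‖w‖ = √(w 0 ^ 2 + (w 1 ^ 2 + w 2 ^ 2)) := by
          rw [EuclideanSpace.norm_eq, Fin.sum_univ_three]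
          simp [add_assoc]
        simp only [h1, h2]
    _ = ∫⁻ x, ENNReal.ofReal (2 * Real.pi) * ∫⁻ q in Ioi 0, ENNReal.ofReal q *
          (ENNReal.ofReal (c ((x - r) ^ 2 + q ^ 2)) * G √(x ^ 2 + q ^ 2)) := by
        refine (lintegral_euclideanSpace_three (F := fun p : ℝ × ℝ × ℝ =>
          ENNReal.ofReal (c ((p.1 - r) ^ 2 + (p.2.1 ^ 2 + p.2.2 ^ 2))) *
            G √(p.1 ^ 2 + (p.2.1 ^ 2 + p.2.2 ^ 2))) (by fun_prop)).trans ?_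
        refine lintegral_congr fun x => ?_
        exact lintegral_comp_sq_add_sq (f := fun y =>
          ENNReal.ofReal (c ((x - r) ^ 2 + y)) * G √(x ^ 2 + y)) (by fun_prop)
    _ = ENNReal.ofReal (2 * Real.pi) * ∫⁻ ρ in Ioi 0, ∫⁻ θ in Ioo 0 Real.pi,
          ENNReal.ofReal ρ * (ENNReal.ofReal (ρ * Real.sin θ) *
            (ENNReal.ofReal (c ((ρ * Real.cos θ - r) ^ 2 + (ρ * Real.sin θ) ^ 2)) *
              G √((ρ * Real.cos θ) ^ 2 + (ρ * Real.sin θ) ^ 2))) := by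
        rw [lintegral_const_mul' _ _ ENNReal.ofReal_ne_top]
        congr 1
        exact lintegral_half_plane (F := fun p : ℝ × ℝ => ENNReal.ofReal p.2 *
          (ENNReal.ofReal (c ((p.1 - r) ^ 2 + p.2 ^ 2)) * G √(p.1 ^ 2 + p.2 ^ 2))) (by fun_prop)
    _ = ∫⁻ ρ in Ioi 0, ENNReal.ofReal (radialDensity t r ρ) * G ρ := by
        rw [← lintegral_const_mul' _ _ ENNReal.ofReal_ne_top]
        refine setLIntegral_congr_fun measurableSet_Ioi fun ρ hρ => ?_
        have hρ0 : 0 < ρ := hρ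
        have e1 : ∀ θ ∈ Ioo 0 Real.pi,
            ENNReal.ofReal ρ * (ENNReal.ofReal (ρ * Real.sin θ) *
              (ENNReal.ofReal (c ((ρ * Real.cos θ - r) ^ 2 + (ρ * Real.sin θ) ^ 2)) *
              G √((ρ * Real.cos θ) ^ 2 + (ρ * Real.sin θ) ^ 2))) =
            ENNReal.ofReal (ρ ^ 2 * t / Real.pi ^ 2) * G ρ * ENNReal.ofReal (Real.sin θ /
              (t ^ 2 + (r ^ 2 + ρ ^ 2 - 2 * r * ρ * Real.cos θ)) ^ 2) := by
          intro θ hθ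
          have hsin := (Real.sin_pos_of_pos_of_lt_pi hθ.1 hθ.2).le
          have h1 : (ρ * Real.cos θ) ^ 2 + (ρ * Real.sin θ) ^ 2 = ρ ^ 2 := by
            linear_combination ρ ^ 2 * Real.cos_sq_add_sin_sq θ
          have h2 : (ρ * Real.cos θ - r) ^ 2 + (ρ * Real.sin θ) ^ 2 =
              r ^ 2 + ρ ^ 2 - 2 * r * ρ * Real.cos θ := by linear_combination h1
          rw [h1, h2, Real.sqrt_sq hρ0.le, mul_right_comm (ENNReal.ofReal (ρ ^ 2 * t / Real.pi ^ 2)),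
            ← ENNReal.ofReal_mul (by positivity),
            ← mul_assoc, ← mul_assoc, ← ENNReal.ofReal_mul hρ0.le,
            ← ENNReal.ofReal_mul (by positivity)]
          congr 2
          simp only [hc]
          rw [div_mul_div_comm]
          ring
        rw [setLIntegral_congr_fun measurableSet_Ioo e1, lintegral_const_mul _ (by fun_prop),
          lintegral_angle ht hr0 hρ0, ← mul_assoc, ← mul_assoc, mul_right_comm,
          ← ENNReal.ofReal_mul (by positivity), ← ENNReal.ofReal_mul (by positivity)]
        congr 2
        unfold radialDensity reflected cauchyDensity
        have := Real.pi_pos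
        field_simp

/-! ### The weighted radial Cauchy chain -/

instance : SFinite halfLine := inferInstanceAs (SFinite (volume.restrict (Ioi 0)))

/-- One step of the radial Cauchy process, weighted by `exp (-b ρ² / 2)`. -/
def radialStep (t b : ℝ) : Kernel ℝ ℝ :=
  (Kernel.const ℝ halfLine).withDensity fun r ρ =>
    ENNReal.ofReal (Real.exp (-(b * ρ ^ 2 / 2)) * radialDensity t r ρ)

instance (t b : ℝ) : IsSFiniteKernel (radialStep t b) := 
  Kernel.IsSFiniteKernel.withDensity _ fun _ _ => ENNReal.ofReal_ne_top

/-- The iterated weighted steps. -/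
def radialKernel (a b : ℕ → ℝ) : ℕ → Kernel ℝ ℝ
  | 0 => Kernel.id
  | k + 1 => radialStep (a k) (b k) ∘ₖ radialKernel a b k

lemma measurable_radialStep_density {t : ℝ} (ht : 0 < t) (b : ℝ) :
    Measurable (Function.uncurry fun r ρ : ℝ =>
      ENNReal.ofReal (Real.exp (-(b * ρ ^ 2 / 2)) * radialDensity t r ρ)) := by
  have := measurable_radialDensity ht
  unfold Function.uncurry at *
  fun_prop

lemma radialStep_apply {t : ℝ} (ht : 0 < t) (b r : ℝ) :
    radialStep t b r = halfLine.withDensity fun ρ =>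
      ENNReal.ofReal (Real.exp (-(b * ρ ^ 2 / 2)) * radialDensity t r ρ) := by
  unfold radialStep
  rw [Kernel.withDensity_apply _ (measurable_radialStep_density ht b), Kernel.const_apply]

lemma lintegral_radialStep {t : ℝ} (ht : 0 < t) (b r : ℝ) {G : ℝ → ℝ≥0∞} (hG : Measurable G) :
    ∫⁻ ρ, G ρ ∂(radialStep t b r) = ∫⁻ ρ in Ioi 0,
      ENNReal.ofReal (Real.exp (-(b * ρ ^ 2 / 2)) * radialDensity t r ρ) * G ρ := by
  have hm : Measurable fun ρ =>
      ENNReal.ofReal (Real.exp (-(b * ρ ^ 2 / 2)) * radialDensity t r ρ) :=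
    (measurable_radialStep_density ht b).of_uncurry_left
  rw [radialStep_apply ht, lintegral_withDensity_eq_lintegral_mul _ hm hG]
  rfl

lemma radialDensity_nonneg {t r ρ : ℝ} (ht : 0 < t) (hr : 0 < r) (hρ : 0 < ρ) :
    0 ≤ radialDensity t r ρ :=
  mul_nonneg (by positivity) ((cosDensity_cauchy ht).reflected_nonneg hr.le hρ.le)

lemma radialStep_absolutelyContinuous {t : ℝ} (ht : 0 < t) (b r : ℝ) :
    radialStep t b r ≪ halfLine := by
  rw [radialStep_apply ht]
  exact withDensity_absolutelyContinuous _ _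

/-- Since g matters only up to null sets, this is needed to integrate it; it starts at one step
because the zeroth kernel is a Dirac mass. -/
lemma radialKernel_succ_absolutelyContinuous {a : ℕ → ℝ} (ha : ∀ k, 0 < a k) (b : ℕ → ℝ) (k : ℕ)
    (r : ℝ) : radialKernel a b (k + 1) r ≪ halfLine := by
  refine Measure.AbsolutelyContinuous.mk fun s hs h0 => ?_
  rw [radialKernel, Kernel.comp_apply' _ _ _ hs]
  simp [radialStep_absolutelyContinuous (ha k) (b k) _ h0]

/-- The chain almost never sits at radius 0, where the transition density would divide by zero. -/
lemma radialKernel_Iic_zero {a : ℕ → ℝ} (ha : ∀ k, 0 < a k) (b : ℕ → ℝ) (k : ℕ) {r : ℝ}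
    (hr : 0 < r) : radialKernel a b k r (Iic 0) = 0 := by
  cases k with
  | zero =>
    rw [radialKernel, Kernel.id_apply, Measure.dirac_apply' _ measurableSet_Iic]
    exact indicator_of_notMem (by simpa using hr) _
  | succ k =>
    refine radialKernel_succ_absolutelyContinuous ha b k r ?_
    rw [halfLine, Measure.restrict_apply measurableSet_Iic, Iic_inter_Ioi, Ioc_self,
      measure_empty]

/-- The factor r in front of `radialPart` cancels the denominator of ρ/r and is replaced by ρ, so
what remains is the reflected Cauchy convolution. -/
lemma radialKernel_comp_withDensity {s₀ : ℝ} {a b : ℕ → ℝ} (hs : 0 < s₀) (ha : ∀ k, 0 < a k)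
    (hb : ∀ k, 0 < b k) (n : ℕ) :
    radialKernel a b n ∘ₘ (halfLine.withDensity fun y =>
        ENNReal.ofReal (y * radialPart s₀ a b 0 y)) =
      halfLine.withDensity fun y => ENNReal.ofReal (y * radialPart s₀ a b n y) := by
  induction n with
  | zero => rw [radialKernel, Measure.id_comp]
  | succ n ih =>
    rw [radialKernel, ← Measure.comp_assoc, ih]
    have hv := isBddDensity_radialPart hs ha hb n
    have hm : ∀ n, Measurable fun y => ENNReal.ofReal (y * radialPart s₀ a b n y) := fun n =>
      (measurable_id.mul (isBddDensity_radialPart hs ha hb n).measurable).ennreal_ofReal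
    refine Measure.ext_of_lintegral _ fun G hG => ?_
    rw [Measure.lintegral_bind (Kernel.aemeasurable _) hG.aemeasurable,
      lintegral_withDensity_eq_lintegral_mul _ (hm n) hG.lintegral_kernel,
      lintegral_withDensity_eq_lintegral_mul _ (hm (n + 1)) hG]
    have hK : Measurable (Function.uncurry fun r ρ : ℝ => ENNReal.ofReal (r * radialPart s₀ a b n r) *
        (ENNReal.ofReal (Real.exp (-(b n * ρ ^ 2 / 2)) * radialDensity (a n) r ρ) * G ρ)) :=
      ((hm n).comp measurable_fst).mul ((measurable_radialStep_density (ha n) (b n)).mul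
        (hG.comp measurable_snd))
    calc ∫⁻ r in Ioi 0, ENNReal.ofReal (r * radialPart s₀ a b n r) *
          ∫⁻ ρ, G ρ ∂(radialStep (a n) (b n) r)
        = ∫⁻ r in Ioi 0, ∫⁻ ρ in Ioi 0, ENNReal.ofReal (r * radialPart s₀ a b n r) *
            (ENNReal.ofReal (Real.exp (-(b n * ρ ^ 2 / 2)) * radialDensity (a n) r ρ) * G ρ) := by
          refine lintegral_congr fun r => ?_
          rw [lintegral_radialStep (ha n) _ _ hG, lintegral_const_mul' _ _ ENNReal.ofReal_ne_top]
      _ = ∫⁻ ρ in Ioi 0, ∫⁻ r in Ioi 0, ENNReal.ofReal (r * radialPart s₀ a b n r) *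
            (ENNReal.ofReal (Real.exp (-(b n * ρ ^ 2 / 2)) * radialDensity (a n) r ρ) * G ρ) :=
          lintegral_lintegral_swap hK.aemeasurable
      _ = ∫⁻ ρ in Ioi 0, ENNReal.ofReal (ρ * radialPart s₀ a b (n + 1) ρ) * G ρ := by
          refine setLIntegral_congr_fun measurableSet_Ioi fun ρ hρ => ?_
          have hρ0 : 0 < ρ := hρ
          simp only [radialPart]
          rw [← mul_assoc ρ, ENNReal.ofReal_mul (by positivity),
            (cosDensity_cauchy (ha n)).ofReal_reflectedConv hv hρ0, mul_right_comm,
            ← lintegral_const_mul _ ?_]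
          · refine setLIntegral_congr_fun measurableSet_Ioi fun r hr => ?_
            have hr0 : 0 < r := hr
            rw [← mul_assoc, ← ENNReal.ofReal_mul (mul_nonneg hr0.le (hv.nonneg r hr0)),
              mul_right_comm (ENNReal.ofReal (ρ * _)), ← ENNReal.ofReal_mul (by positivity)]
            congr 2
            unfold radialDensity
            field_simp
          · exact (hv.measurable.mul
              ((cosDensity_cauchy (ha n)).measurable_reflected.comp
                measurable_prodMk_right)).ennreal_ofReal

/-- The difference of the two Cauchy terms has numerator 4rρ, which cancels 1/r; each denominator is
at least t². The bound is uniform in r. -/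
lemma radialDensity_le {t r ρ : ℝ} (ht : 0 < t) (hr : 0 < r) (hρ : 0 < ρ) :
    radialDensity t r ρ ≤ 4 / (Real.pi * t ^ 3) * ρ ^ 2 := by
  have h1 : radialDensity t r ρ =
      t / Real.pi * (4 * ρ ^ 2) / ((t ^ 2 + (r - ρ) ^ 2) * (t ^ 2 + (r + ρ) ^ 2)) := by
    have h1 : t ^ 2 + (r - ρ) ^ 2 ≠ 0 := by positivity
    have h2 : t ^ 2 + (r + ρ) ^ 2 ≠ 0 := by positivity
    unfold radialDensity reflected cauchyDensity
    field_simp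
    ring
  have h2 : 4 / (Real.pi * t ^ 3) * ρ ^ 2 = t / Real.pi * (4 * ρ ^ 2) / (t ^ 2 * t ^ 2) := by
    field_simp
  rw [h1, h2]
  gcongr
  · nlinarith [sq_nonneg (r - ρ)]
  · nlinarith [sq_nonneg (r + ρ)]

/-- This holds for every starting radius: the last transition density is at most a constant times
ρ², whatever the previous radius, and the earlier steps contribute only a finite mass. -/
lemma integrable_radialKernel {E : Type*} [NormedAddCommGroup E] {a b : ℕ → ℝ}
    (ha : ∀ k, 0 < a k) (n : ℕ) {r : ℝ} (hr : 0 < r)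
    (hfin : ∀ k, radialKernel a b k r univ < ⊤) {g : ℝ → E} (hg : AEStronglyMeasurable g halfLine)
    (hi : ∀ k, ∫⁻ ρ in Ioi 0, ENNReal.ofReal (ρ ^ 2 * Real.exp (-(b k * ρ ^ 2 / 2))) * ‖g ρ‖ₑ < ⊤) :
    Integrable g (radialKernel a b n r) := by
  cases n with
  | zero =>
    rw [radialKernel, Kernel.id_apply]
    exact integrable_dirac (by simp)
  | succ n =>
    have hac := radialKernel_succ_absolutelyContinuous ha b n r
    refine ⟨hg.mono_ac hac, ?_⟩
    obtain ⟨g', hg', hgg'⟩ := hg.enorm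
    have hi' : ∫⁻ ρ in Ioi 0, ENNReal.ofReal (ρ ^ 2 * Real.exp (-(b n * ρ ^ 2 / 2))) * g' ρ < ⊤ := by
      refine lt_of_eq_of_lt (lintegral_congr_ae ?_) (hi n)
      filter_upwards [hgg'] with ρ hρ
      rw [hρ]
    rw [hasFiniteIntegral_iff_enorm, lintegral_congr_ae (hac.ae_eq hgg'), radialKernel,
      Kernel.lintegral_comp _ _ _ hg']
    set C := ∫⁻ ρ in Ioi 0, ENNReal.ofReal (ρ ^ 2 * Real.exp (-(b n * ρ ^ 2 / 2))) * g' ρ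
    have hpos : ∀ᵐ y ∂(radialKernel a b n r), 0 < y := by
      rw [ae_iff]
      convert radialKernel_Iic_zero ha b n hr using 2
      ext; simp
    calc ∫⁻ y, ∫⁻ ρ, g' ρ ∂(radialStep (a n) (b n) y) ∂(radialKernel a b n r)
        ≤ ∫⁻ y, ENNReal.ofReal (4 / (Real.pi * a n ^ 3)) * C ∂(radialKernel a b n r) := by
          refine lintegral_mono_ae ?_
          filter_upwards [hpos] with y hy
          rw [lintegral_radialStep (ha n) _ _ hg', ← lintegral_const_mul' _ _ ENNReal.ofReal_ne_top]
          refine setLIntegral_mono_ae' measurableSet_Ioi (ae_of_all _ fun ρ hρ => ?_)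
          have h3 := pow_pos (ha n) 3
          rw [← mul_assoc, ← ENNReal.ofReal_mul (by positivity)]
          refine mul_le_mul_left (ENNReal.ofReal_le_ofReal ?_) _
          calc Real.exp (-(b n * ρ ^ 2 / 2)) * radialDensity (a n) y ρ
              ≤ Real.exp (-(b n * ρ ^ 2 / 2)) * (4 / (Real.pi * a n ^ 3) * ρ ^ 2) := by
                gcongr
                exact radialDensity_le (ha n) hy hρ
            _ = _ := by ring
      _ < ⊤ := by
          rw [lintegral_const]
          exact ENNReal.mul_lt_top (ENNReal.mul_lt_top ENNReal.ofReal_lt_top hi') (hfin n)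

/-! ### The weighted law of the radial Cauchy process -/

section process
variable {Ω : Type*} [MeasurableSpace Ω] {P : Measure Ω}
  {Z : ℝ≥0 → Ω → EuclideanSpace ℝ (Fin 3)} {x : EuclideanSpace ℝ (Fin 3)} {T : ℕ → ℝ≥0}

/-- The weight accumulated after `k` steps. -/
def radialWeight (Z : ℝ≥0 → Ω → EuclideanSpace ℝ (Fin 3)) (T : ℕ → ℝ≥0) (b : ℕ → ℝ) (k : ℕ)
    (ω : Ω) : ℝ :=
  Real.exp (-(1 / 2) * ∑ j ∈ Finset.range k, b j * ‖Z (T (j + 1)) ω‖ ^ 2)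

lemma measurable_radialWeight (hZ : IsCauchyProcess Z x P) (b : ℕ → ℝ) (k : ℕ) :
    Measurable (radialWeight Z T b k) := by
  have := hZ.measurable
  unfold radialWeight
  fun_prop

/-- Weight and position are almost surely functions of the starting point and the first k
increments, which are independent of the next one. -/
lemma IsCauchyProcess.indepFun_past (hZ : IsCauchyProcess Z x P) (hT : StrictMono T) (hT0 : T 0 = 0)
    (b : ℕ → ℝ) (k : ℕ) :
    IndepFun (fun ω => (ENNReal.ofReal (radialWeight Z T b k ω), Z (T k) ω))
      (fun ω => Z (T (k + 1)) ω - Z (T k) ω) P := by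
  have hind := hZ.indep_increments.nat hT.monotone
  have hmeas : ∀ i, Measurable fun ω => Z (T (i + 1)) ω - Z (T i) ω := fun i =>
    (hZ.measurable _).sub (hZ.measurable _)
  have h1 := hind.indepFun_finset (Finset.range k) {k} (by simp) hmeas
  -- Rebuilds the position at time `T j` by telescoping the increments.
  let pos : ℕ → (Finset.range k → EuclideanSpace ℝ (Fin 3)) → EuclideanSpace ℝ (Fin 3) :=
    fun j ξ => x + ∑ i : Finset.range k, if (i : ℕ) < j then ξ i else 0
  have hpos : ∀ j, Measurable (pos j) := fun j => by
    refine measurable_const.add (Finset.measurable_sum _ fun i _ => ?_)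
    split_ifs
    · exact measurable_pi_apply i
    · exact measurable_const
  have hpos_eq : ∀ᵐ ω ∂P, ∀ j ≤ k,
      pos j (fun i : Finset.range k => Z (T (i + 1)) ω - Z (T i) ω) = Z (T j) ω := by
    filter_upwards [hZ.start] with ω hω j hj
    simp only [pos]
    rw [Finset.sum_coe_sort (Finset.range k)
      (fun i => if i < j then Z (T (i + 1)) ω - Z (T i) ω else 0), ← Finset.sum_filter]
    have : (Finset.range k).filter (· < j) = Finset.range j := by ext; simp; omega
    rw [this, Finset.sum_range_sub (fun i => Z (T i) ω), hT0, hω]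
    abel
  let Φ : (Finset.range k → EuclideanSpace ℝ (Fin 3)) → ℝ≥0∞ × EuclideanSpace ℝ (Fin 3) := fun ξ =>
    (ENNReal.ofReal (Real.exp (-(1 / 2) * ∑ j ∈ Finset.range k, b j * ‖pos (j + 1) ξ‖ ^ 2)),
      pos k ξ)
  have hΦ : Measurable Φ := by fun_prop
  have hψ : Measurable fun ξ : ({k} : Finset ℕ) → EuclideanSpace ℝ (Fin 3) =>
      ξ ⟨k, by simp⟩ := measurable_pi_apply _
  have h2 := h1.comp (φ := Φ) hΦ hψ
  refine h2.congr ?_ (ae_of_all _ fun ω => rfl)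
  filter_upwards [hpos_eq] with ω hω
  simp only [Function.comp_apply, Φ, radialWeight]
  have e : ∀ j ∈ Finset.range k, b j * ‖pos (j + 1) (fun i : Finset.range k =>
      Z (T (i + 1)) ω - Z (T i) ω)‖ ^ 2 = b j * ‖Z (T (j + 1)) ω‖ ^ 2 := fun j hj => by
    rw [hω (j + 1) (by simpa using hj)]
  rw [hω k le_rfl, Finset.sum_congr rfl e]

/-- The Markov property by induction: condition on the past, then integrate the independent
increment, whose effect on the norm depends only on the current norm. -/
lemma IsCauchyProcess.lintegral_radialWeight [IsProbabilityMeasure P] (hZ : IsCauchyProcess Z x P) (hx : x ≠ 0)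
    (hT : StrictMono T) (hT0 : T 0 = 0) (b : ℕ → ℝ) (k : ℕ) {G : ℝ → ℝ≥0∞} (hG : Measurable G) :
    ∫⁻ ω, ENNReal.ofReal (radialWeight Z T b k ω) * G ‖Z (T k) ω‖ ∂P =
      ∫⁻ ρ, G ρ ∂(radialKernel (fun j => (T (j + 1) : ℝ) - T j) b k ‖x‖) := by
  have ha : ∀ j, 0 < (T (j + 1) : ℝ) - T j := fun j =>
    sub_pos.2 (NNReal.coe_lt_coe.2 (hT j.lt_succ_self))
  induction k generalizing G with
  | zero =>
    rw [radialKernel, Kernel.id_apply, lintegral_dirac' _ hG]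
    have : ∀ᵐ ω ∂P, ENNReal.ofReal (radialWeight Z T b 0 ω) * G ‖Z (T 0) ω‖ = G ‖x‖ := by
      filter_upwards [hZ.start] with ω hω
      simp [radialWeight, hT0, hω]
    rw [lintegral_congr_ae this]
    simp
  | succ k ih =>
    -- The induction hypothesis for the indicator of (-∞, 0] gives zero; as the weight is positive,
    -- the process avoids the origin at this time.
    have hne : ∀ᵐ ω ∂P, Z (T k) ω ≠ 0 := by
      have h0 := ih (G := (Iic 0).indicator 1) (measurable_one.indicator measurableSet_Iic)
      rw [lintegral_indicator_one measurableSet_Iic,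
        radialKernel_Iic_zero ha b k (norm_pos_iff.2 hx), lintegral_eq_zero_iff] at h0
      · filter_upwards [h0] with ω hω hz
        have : 0 < radialWeight Z T b k ω := Real.exp_pos _
        simp [hz, this.not_ge] at hω
      · exact (measurable_radialWeight hZ b k).ennreal_ofReal.mul
          ((measurable_one.indicator measurableSet_Iic).comp (hZ.measurable _).norm)
    set G' : ℝ → ℝ≥0∞ := fun ρ => ENNReal.ofReal (Real.exp (-(b k * ρ ^ 2 / 2))) * G ρ with hG'
    have hG'm : Measurable G' := by fun_prop
    have hlaw := hZ.increment_law (T k) (T (k + 1)) (hT k.lt_succ_self)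
    have hWm := measurable_radialWeight (T := T) hZ b k
    have : SFinite (cauchyLaw ((T (k + 1) : ℝ) - T k)) := by unfold cauchyLaw; infer_instance
    have hprod : P.map (fun ω => ((ENNReal.ofReal (radialWeight Z T b k ω), Z (T k) ω),
          Z (T (k + 1)) ω - Z (T k) ω)) =
        (P.map fun ω => (ENNReal.ofReal (radialWeight Z T b k ω), Z (T k) ω)).prod
          (P.map fun ω => Z (T (k + 1)) ω - Z (T k) ω) := (indepFun_iff_map_prod_eq_prod_map_map
      (hWm.ennreal_ofReal.prodMk (hZ.measurable (T k))).aemeasurable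
      ((hZ.measurable (T (k + 1))).sub (hZ.measurable (T k))).aemeasurable).1
      (hZ.indepFun_past hT hT0 b k)
    have hlaw' : P.map (fun ω => Z (T (k + 1)) ω - Z (T k) ω) =
      cauchyLaw ((T (k + 1) : ℝ) - T k) := hlaw.map_eq
    have hF : Measurable fun q : (ℝ≥0∞ × EuclideanSpace ℝ (Fin 3)) × EuclideanSpace ℝ (Fin 3) =>
        q.1.1 * G' ‖q.1.2 + q.2‖ := by fun_prop
    calc ∫⁻ ω, ENNReal.ofReal (radialWeight Z T b (k + 1) ω) * G ‖Z (T (k + 1)) ω‖ ∂P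
        = ∫⁻ ω, (fun q : (ℝ≥0∞ × EuclideanSpace ℝ (Fin 3)) × EuclideanSpace ℝ (Fin 3) =>
            q.1.1 * G' ‖q.1.2 + q.2‖) ((ENNReal.ofReal (radialWeight Z T b k ω), Z (T k) ω),
              Z (T (k + 1)) ω - Z (T k) ω) ∂P := by
          refine lintegral_congr fun ω => ?_
          simp only [hG', add_sub_cancel, radialWeight]
          rw [← mul_assoc, ← ENNReal.ofReal_mul (Real.exp_nonneg _), ← Real.exp_add,
            Finset.sum_range_succ]
          congr 3
          ring
      _ = ∫⁻ q, q.1.1 * G' ‖q.1.2 + q.2‖ ∂((P.map fun ω =>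
            (ENNReal.ofReal (radialWeight Z T b k ω), Z (T k) ω)).prod
              (cauchyLaw ((T (k + 1) : ℝ) - T k))) := by
          rw [← hlaw', ← hprod, lintegral_map hF]
          exact (hWm.ennreal_ofReal.prodMk (hZ.measurable (T k))).prodMk
            ((hZ.measurable (T (k + 1))).sub (hZ.measurable (T k)))
      _ = ∫⁻ ω, ENNReal.ofReal (radialWeight Z T b k ω) *
            ∫⁻ ξ, G' ‖Z (T k) ω + ξ‖ ∂(cauchyLaw ((T (k + 1) : ℝ) - T k)) ∂P := by
          rw [lintegral_prod _ hF.aemeasurable, lintegral_map hF.lintegral_prod_right'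
            (hWm.ennreal_ofReal.prodMk (hZ.measurable (T k)))]
          refine lintegral_congr fun ω => ?_
          rw [lintegral_const_mul' _ _ ENNReal.ofReal_ne_top]
      _ = ∫⁻ ω, ENNReal.ofReal (radialWeight Z T b k ω) *
            (fun r => ∫⁻ ρ, G ρ ∂(radialStep ((T (k + 1) : ℝ) - T k) (b k) r)) ‖Z (T k) ω‖ ∂P := by
          refine lintegral_congr_ae ?_
          filter_upwards [hne] with ω hω
          rw [lintegral_cauchyLaw (ha k) hω hG'm, lintegral_radialStep (ha k) _ _ hG]
          congr 1
          refine setLIntegral_congr_fun measurableSet_Ioi fun ρ hρ => ?_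
          simp only [hG']
          rw [← mul_assoc, ← ENNReal.ofReal_mul
            (radialDensity_nonneg (ha k) (norm_pos_iff.2 hω) hρ), mul_comm (radialDensity _ _ _)]
      _ = _ := by
          rw [ih hG.lintegral_kernel, radialKernel, Kernel.lintegral_comp _ _ _ hG]

lemma IsCauchyProcess.map_withDensity_radialWeight [IsProbabilityMeasure P] (hZ : IsCauchyProcess Z x P) (hx : x ≠ 0)
    (hT : StrictMono T) (hT0 : T 0 = 0) (b : ℕ → ℝ) (k : ℕ) :
    (P.withDensity fun ω => ENNReal.ofReal (radialWeight Z T b k ω)).map (fun ω => ‖Z (T k) ω‖) =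
      radialKernel (fun j => (T (j + 1) : ℝ) - T j) b k ‖x‖ := by
  refine Measure.ext_of_lintegral _ fun G hG => ?_
  have hm := (hZ.measurable (T k)).norm
  rw [lintegral_map hG hm, lintegral_withDensity_eq_lintegral_mul _
    (measurable_radialWeight hZ b k).ennreal_ofReal
    (show Measurable fun ω => G ‖Z (T k) ω‖ from hG.comp hm), ← hZ.lintegral_radialWeight hx hT hT0 b k hG]
  rfl

end process

/-! ### Change of measure -/

lemma integrable_and_integral_of_map_withDensity {α : Type*} [MeasurableSpace α] {μ : Measure α}
    {W : α → ℝ} (hW : Measurable W) (hW0 : 0 ≤ᵐ[μ] W) {X : α → ℝ} (hX : Measurable X)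
    {ν : Measure ℝ} (hν : (μ.withDensity fun ω => ENNReal.ofReal (W ω)).map X = ν) {g : ℝ → ℂ}
    (hg : AEStronglyMeasurable g ν) :
    (Integrable (fun ω => (W ω : ℂ) * g (X ω)) μ ↔ Integrable g ν) ∧
      ∫ ω, (W ω : ℂ) * g (X ω) ∂μ = ∫ x, g x ∂ν := by
  have hWm := hW.ennreal_ofReal
  have e : (fun ω => (ENNReal.ofReal (W ω)).toReal • g (X ω)) =ᵐ[μ]
      fun ω => (W ω : ℂ) * g (X ω) := by
    filter_upwards [hW0] with ω hω
    rw [ENNReal.toReal_ofReal hω, Complex.real_smul]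
  subst hν
  constructor
  · rw [integrable_map_measure hg hX.aemeasurable, integrable_withDensity_iff_integrable_smul' hWm
      (ae_of_all _ fun _ => ENNReal.ofReal_lt_top), ← integrable_congr e]
    rfl
  · rw [integral_map hX.aemeasurable hg, integral_withDensity_eq_integral_toReal_smul hWm
      (ae_of_all _ fun _ => ENNReal.ofReal_lt_top), integral_congr_ae e]

lemma integrable_and_integral_withDensity_halfLine {d : ℝ → ℝ} (hd : Measurable d)
    (hd0 : ∀ x, 0 < x → 0 ≤ d x) {g : ℝ → ℂ} (hg : AEStronglyMeasurable g halfLine) :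
    (Integrable (fun x => (d x : ℂ) * g x) halfLine ↔
      Integrable g (halfLine.withDensity fun x => ENNReal.ofReal (d x))) ∧
      ∫ x, (d x : ℂ) * g x ∂halfLine =
        ∫ x, g x ∂(halfLine.withDensity fun x => ENNReal.ofReal (d x)) := by
  refine integrable_and_integral_of_map_withDensity hd ?_ measurable_id Measure.map_id
    (hg.mono_ac (withDensity_absolutelyContinuous _ _))
  filter_upwards [ae_restrict_mem (μ := volume) measurableSet_Ioi] with x hx using hd0 x hx

/-- Recovers the measurability of f and g, which is assumed only for hf and yg. -/
lemma AEStronglyMeasurable.of_ofReal_mul {d : ℝ → ℝ} (hd : Measurable d)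
    (hd0 : ∀ x, 0 < x → d x ≠ 0) {g : ℝ → ℂ}
    (hg : AEStronglyMeasurable (fun x => (d x : ℂ) * g x) halfLine) :
    AEStronglyMeasurable g halfLine := by
  have hm : Measurable fun x => ((d x)⁻¹ : ℂ) := (Complex.measurable_ofReal.comp hd).inv
  refine (hm.aestronglyMeasurable.mul hg).congr ?_
  filter_upwards [ae_restrict_mem (μ := volume) measurableSet_Ioi] with x hx
  have : (d x : ℂ) ≠ 0 := Complex.ofReal_ne_zero.2 (hd0 x hx)
  simp [this]

/-! ### The duality -/

section duality
variable {Ω Ω' : Type*} [MeasurableSpace Ω] [MeasurableSpace Ω'] {μ : Measure Ω}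
  {B : unitInterval → Ω → ℝ} {P : ℝ → Measure Ω'} [∀ y, IsProbabilityMeasure (P y)]
  {Y : ℝ≥0 → Ω' → ℝ} {S : ℕ → ℝ} {T : ℕ → ℝ≥0} {n : ℕ}
  {s : Fin (n + 1) → unitInterval} {f g : ℝ → ℂ}

/-- Integrability is Cauchy–Schwarz between `killedPart` and hf. -/
lemma excursion_side (hB : IsBrownianExcursion B μ) (hS : StrictMono S) (hS0 : 0 < S 0)
    {a : ℕ → ℝ} (ha : ∀ k, 0 < a k) (hs : ∀ k, (s k : ℝ) = S k) (hSn : S n < 1)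
    (hf : MemLp (fun x => (h (S n) x : ℂ) * f x) 2 halfLine) :
    Integrable (fun ω => (Real.exp (-∑ k : Fin n, a k * B (s k.castSucc) ω) : ℂ) *
      f (B (s (Fin.last n)) ω)) μ ∧
    ∫ ω, (Real.exp (-∑ k : Fin n, a k * B (s k.castSucc) ω) : ℂ) * f (B (s (Fin.last n)) ω) ∂μ =
      ∫ x in Ioi 0, (killedPart (S 0) a (fun j => S (j + 1) - S j) n x : ℂ) *
        ((h (S n) x : ℂ) * f x) := by
  have hu := isBddDensity_killedPart hS0 ha (fun k => sub_pos.2 (hS k.lt_succ_self)) n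
  have hfm : AEStronglyMeasurable f halfLine :=
    AEStronglyMeasurable.of_ofReal_mul (measurable_h _) (fun x hx => (h_pos hSn hx).ne')
      hf.aestronglyMeasurable
  have hBm := hB.measurable
  have h1 := integrable_and_integral_of_map_withDensity
    (W := fun ω => Real.exp (-∑ k : Fin n, a k * B (s k.castSucc) ω)) (by fun_prop)
    (ae_of_all μ fun ω => Real.exp_nonneg _) (hBm _) (hB.map_withDensity hS hS0 ha hs hSn)
    (hfm.mono_ac (withDensity_absolutelyContinuous _ _))
  have h2 := integrable_and_integral_withDensity_halfLine
    (d := fun x => h (S n) x * killedPart (S 0) a (fun j => S (j + 1) - S j) n x)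
    ((measurable_h _).mul hu.measurable)
    (fun x hx => mul_nonneg (h_pos hSn hx).le (hu.nonneg x hx)) hfm
  have e : (fun x => ((h (S n) x * killedPart (S 0) a (fun j => S (j + 1) - S j) n x : ℝ) : ℂ) *
      f x) = fun x => (killedPart (S 0) a (fun j => S (j + 1) - S j) n x : ℂ) *
        ((h (S n) x : ℂ) * f x) := by
    funext x; push_cast; ring
  rw [e] at h2
  exact ⟨h1.1.2 (h2.1.1 (hu.memLp_two.integrable_mul hf)), h1.2.trans h2.2.symm⟩

lemma radial_side (hY : ∀ y : ℝ, 0 < y → IsRadialCauchyProcess Y y (P y))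
    (hT : StrictMono T) (hT0 : T 0 = 0) {b : ℕ → ℝ} (hb : ∀ k, 0 < b k) {s₀ : ℝ} (hs₀ : 0 < s₀)
    (hg : MemLp (fun y : ℝ => (y : ℂ) * g y) 2 halfLine) :
    (∀ y : ℝ, 0 < y → Integrable (fun ω => (Real.exp (-(1 / 2) * ∑ k : Fin n,
        b k * Y (T (k + 1)) ω ^ 2) : ℂ) * g (Y (T n) ω)) (P y)) ∧
    IntegrableOn (fun y : ℝ => (∫ ω, (Real.exp (-(1 / 2) * ∑ k : Fin n,
        b k * Y (T (k + 1)) ω ^ 2) : ℂ) * g (Y (T n) ω) ∂(P y)) *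
      ((y ^ 2 * Real.exp (-(1 / 2) * s₀ * y ^ 2) : ℝ) : ℂ)) (Ioi 0) ∧
    2 * ∫ y in Ioi (0 : ℝ), (∫ ω, (Real.exp (-(1 / 2) * ∑ k : Fin n,
        b k * Y (T (k + 1)) ω ^ 2) : ℂ) * g (Y (T n) ω) ∂(P y)) *
      ((y ^ 2 * Real.exp (-(1 / 2) * s₀ * y ^ 2) : ℝ) : ℂ) =
      ∫ y in Ioi 0, (radialPart s₀ (fun j => (T (j + 1) : ℝ) - T j) b n y : ℂ) *
        ((y : ℂ) * g y) := by
  set a : ℕ → ℝ := fun j => (T (j + 1) : ℝ) - T j with ha'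
  have ha : ∀ j, 0 < a j := fun j => sub_pos.2 (NNReal.coe_lt_coe.2 (hT j.lt_succ_self))
  have hv := isBddDensity_radialPart hs₀ ha hb
  have hgm : AEStronglyMeasurable g halfLine :=
    AEStronglyMeasurable.of_ofReal_mul measurable_id (fun x hx => hx.ne') hg.aestronglyMeasurable
  have hgi : ∀ k, ∫⁻ ρ in Ioi 0,
      ENNReal.ofReal (ρ ^ 2 * Real.exp (-(b k * ρ ^ 2 / 2))) * ‖g ρ‖ₑ < ⊤ := by
    intro k
    -- Of the factor ρ², one ρ goes with the Gaussian and one with g; both products are square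
    -- integrable.
    have h1 := (isBddDensity_mul_exp_neg_sq (half_pos (hb k))).memLp_two.integrable_mul hg
    refine lt_of_eq_of_lt (setLIntegral_congr_fun measurableSet_Ioi fun ρ hρ => ?_)
      (hasFiniteIntegral_iff_enorm.1 h1.2)
    have hρ0 : 0 < ρ := hρ
    simp only [Pi.mul_apply]
    rw [← mul_assoc, enorm_mul, ← Complex.ofReal_mul,
      ← ofReal_norm (Complex.ofReal _), Complex.norm_real, Real.norm_of_nonneg (by positivity)]
    congr 2
    ring_nf
  have law : ∀ y : ℝ, 0 < y →
      Integrable g (radialKernel a b n y) ∧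
      Integrable (fun ω => (Real.exp (-(1 / 2) * ∑ k : Fin n,
        b k * Y (T (k + 1)) ω ^ 2) : ℂ) * g (Y (T n) ω)) (P y) ∧
      ∫ ω, (Real.exp (-(1 / 2) * ∑ k : Fin n,
        b k * Y (T (k + 1)) ω ^ 2) : ℂ) * g (Y (T n) ω) ∂(P y) = ∫ ρ, g ρ ∂(radialKernel a b n y) := by
    intro y hy
    obtain ⟨Z, x, hxy, hZ, hYZ⟩ := hY y hy
    have hx : x ≠ 0 := norm_pos_iff.1 (hxy ▸ hy)
    have hfin : ∀ k, radialKernel a b k y univ < ⊤ := by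
      intro k
      have h1 := hZ.lintegral_radialWeight hx hT hT0 b k (measurable_one (α := ℝ≥0∞))
      simp only [Pi.one_apply, lintegral_one, mul_one, hxy] at h1
      rw [← h1]
      refine lt_of_le_of_lt (lintegral_mono (g := fun _ => 1) fun ω => ?_) (by simp)
      refine ENNReal.ofReal_le_one.2 (Real.exp_le_one_iff.2 ?_)
      have : 0 ≤ ∑ j ∈ Finset.range k, b j * ‖Z (T (j + 1)) ω‖ ^ 2 :=
        Finset.sum_nonneg fun j _ => mul_nonneg (hb j).le (sq_nonneg _)
      linarith
    have hint := integrable_radialKernel ha n hy hfin hgm hgi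
    have h1 := integrable_and_integral_of_map_withDensity
      (measurable_radialWeight (T := T) hZ b n) (ae_of_all _ fun ω => (Real.exp_pos _).le)
      (hZ.measurable _).norm (hxy ▸ hZ.map_withDensity_radialWeight hx hT hT0 b n)
      hint.aestronglyMeasurable
    have e : (fun ω => (Real.exp (-(1 / 2) * ∑ k : Fin n,
        b k * Y (T (k + 1)) ω ^ 2) : ℂ) * g (Y (T n) ω)) =
        fun ω => (radialWeight Z T b n ω : ℂ) * g ‖Z (T n) ω‖ := by
      funext ω
      simp only [hYZ, radialWeight]
      rw [Fin.sum_univ_eq_sum_range (fun k => b k * ‖Z (T (k + 1)) ω‖ ^ 2) n]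
    rw [e]
    exact ⟨hint, h1.1.2 hint, h1.2⟩
  have hd : ∀ k, Measurable fun y => y * radialPart s₀ a b k y := fun k =>
    measurable_id.mul (hv k).measurable
  have hd0 : ∀ k y, 0 < y → 0 ≤ y * radialPart s₀ a b k y := fun k y hy =>
    mul_nonneg hy.le ((hv k).nonneg y hy)
  have e : (fun y : ℝ => ((y * radialPart s₀ a b n y : ℝ) : ℂ) * g y) =
      fun y => (radialPart s₀ a b n y : ℂ) * ((y : ℂ) * g y) := by
    funext x; push_cast; ring
  have h2 := integrable_and_integral_withDensity_halfLine (hd n) (hd0 n) hgm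
  rw [e] at h2
  -- Integrability against the composed measure, by Cauchy–Schwarz; Fubini for kernels then gives
  -- integrability of the inner integral in y.
  have hI := h2.1.1 ((hv n).memLp_two.integrable_mul hg)
  have h2' := h2.2
  rw [← radialKernel_comp_withDensity hs₀ ha hb n, Measure.comp_eq_comp_const_apply] at hI h2'
  have h3 := hI.integral_comp
  rw [Kernel.integral_comp hI] at h2'
  simp only [Kernel.const_apply] at h3 h2'
  have h4 := integrable_and_integral_withDensity_halfLine (hd 0) (hd0 0)
    (g := fun y => ∫ ρ, g ρ ∂(radialKernel a b n y)) ?_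
  · have e2 : ∀ y ∈ Ioi (0 : ℝ), ((y * radialPart s₀ a b 0 y : ℝ) : ℂ) *
        ∫ ρ, g ρ ∂(radialKernel a b n y) =
        2 * ((∫ ω, (Real.exp (-(1 / 2) * ∑ k : Fin n,
          b k * Y (T (k + 1)) ω ^ 2) : ℂ) * g (Y (T n) ω) ∂(P y)) *
          ((y ^ 2 * Real.exp (-(1 / 2) * s₀ * y ^ 2) : ℝ) : ℂ)) := by
      intro y hy
      rw [(law y hy).2.2, radialPart, show -(1 / 2) * s₀ * y ^ 2 = -(s₀ * y ^ 2 / 2) by ring]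
      push_cast
      ring
    refine ⟨fun y hy => (law y hy).2.1, ?_, ?_⟩
    · have h5 : IntegrableOn (fun y : ℝ => ((y * radialPart s₀ a b 0 y : ℝ) : ℂ) *
          ∫ ρ, g ρ ∂(radialKernel a b n y)) (Ioi 0) := h4.1.2 h3
      refine ((h5.congr_fun e2 measurableSet_Ioi).const_mul (1 / 2)).congr (ae_of_all _ fun y => ?_)
      ring
    · rw [← integral_const_mul, ← setIntegral_congr_fun measurableSet_Ioi e2]
      exact h4.2.trans h2'.symm
  -- The initial density is positive on the half-line, so Lebesgue measure there is absolutely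
  -- continuous with respect to the initial measure.
  · refine h3.aestronglyMeasurable.mono_ac
      (withDensity_absolutelyContinuous' (hd 0).ennreal_ofReal.aemeasurable ?_)
    filter_upwards [ae_restrict_mem (μ := volume) measurableSet_Ioi] with y hy
    have hy0 : 0 < y := hy
    have : 0 < y * radialPart s₀ a b 0 y := by simp only [radialPart]; positivity
    simpa using this

/-- Continuing by unit steps lets the recursions run over all of `ℕ`; the added values play no role.
-/
lemma exists_strictMono_extension {R : Type*} [Semiring R] [PartialOrder R] [IsStrictOrderedRing R]
    {n : ℕ} {t : Fin (n + 1) → R} (ht : StrictMono t) :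
    ∃ T : ℕ → R, StrictMono T ∧ ∀ k : Fin (n + 1), t k = T k := by
  refine ⟨fun k => t ⟨min k n, by omega⟩ + ((k - n : ℕ) : R), strictMono_nat_of_lt_succ fun k => ?_,
    fun k => ?_⟩
  · rcases lt_or_ge k n with hk | hk
    · have h1 : k - n = 0 := by omega
      have h2 : k + 1 - n = 0 := by omega
      simp only [h1, h2, Nat.cast_zero, add_zero]
      exact ht (by simp only [Fin.mk_lt_mk]; omega)
    · have h1 : min k n = n := by omega
      have h2 : min (k + 1) n = n := by omega
      simp only [h1, h2]
      gcongr
      omega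
  · have h1 : min (k : ℕ) n = k := by omega
    have h2 : (k : ℕ) - n = 0 := by omega
    simp [h1, h2]

end duality

/-! ### Regrouping the time steps for the Laplace transform -/

section laplace
variable {Q : ℕ → ℝ} {n : ℕ}

/-- The times `Q 1, …, Q n`, followed by the midpoint of `Q n` and `1`. -/
def shiftedTimes (Q : ℕ → ℝ) (n k : ℕ) : ℝ := if k = n then (Q n + 1) / 2 else Q (k + 1)

lemma strictMono_shiftedTimes (hQ : StrictMono Q) (hQ1 : Q (n + 1) = 1) :
    StrictMono (shiftedTimes Q n) := by
  have h1 := hQ (Nat.lt_succ_self n)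
  refine strictMono_nat_of_lt_succ fun k => ?_
  unfold shiftedTimes
  rcases lt_trichotomy k n with hk | rfl | hk
  · rw [if_neg hk.ne]
    split_ifs with h
    · rw [h]; linarith
    · exact hQ (by omega)
  · have h2 := hQ (Nat.lt_succ_self (k + 1))
    rw [if_pos rfl, if_neg (by omega)]
    linarith
  · rw [if_neg hk.ne', if_neg (by omega)]
    exact hQ (by omega)

/-- The last interval is cut at the auxiliary time. The three terms become the initial weight, the
weights along the chain and the exponent of g. -/
lemma sum_shiftedTimes (hQ0 : Q 0 = 0) (hQ1 : Q (n + 1) = 1) (c : ℕ → ℝ) :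
    ∑ k ∈ Finset.range (n + 1), (Q (k + 1) - Q k) * c k =
      shiftedTimes Q n 0 * c 0 +
        ∑ k ∈ Finset.range n, (shiftedTimes Q n (k + 1) - shiftedTimes Q n k) * c (k + 1) +
        (1 - shiftedTimes Q n n) * c n := by
  cases n with
  | zero => simp [hQ0, hQ1]; ring
  | succ m =>
    rw [Finset.sum_range_succ', Finset.sum_range_succ, Finset.sum_range_succ _ m]
    have e : ∀ k ∈ Finset.range m, (shiftedTimes Q (m + 1) (k + 1) - shiftedTimes Q (m + 1) k) *
        c (k + 1) = (Q (k + 1 + 1) - Q (k + 1)) * c (k + 1) := by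
      intro k hk
      have hk' := Finset.mem_range.1 hk
      rw [shiftedTimes, shiftedTimes, if_neg (by omega), if_neg (by omega)]
    rw [Finset.sum_congr rfl e]
    have h0 : shiftedTimes Q (m + 1) 0 = Q 1 := if_neg (by omega)
    have h1 : shiftedTimes Q (m + 1) m = Q (m + 1) := if_neg (by omega)
    rw [h0, h1, hQ0, hQ1]
    simp only [zero_add]
    ring

end laplace

end DualLaplace

end

/-! ### The proposition -/

theorem proposition3p4
    {Ω Ω' : Type*} [MeasurableSpace Ω] [MeasurableSpace Ω']
    -- a normalized Brownian excursion
    (μ : Measure Ω) [IsProbabilityMeasure μ] (B : unitInterval → Ω → ℝ)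
    (hB : DualLaplace.IsBrownianExcursion B μ)
    -- the radial part of a 3-dimensional Cauchy process; `P y` is its law given `Y 0 = y`
    (P : ℝ → Measure Ω') [∀ y, IsProbabilityMeasure (P y)] (Y : ℝ≥0 → Ω' → ℝ)
    (hY : ∀ y : ℝ, 0 < y → DualLaplace.IsRadialCauchyProcess Y y (P y))
    (n : ℕ) (t : Fin (n + 1) → ℝ≥0) (ht : StrictMono t) (ht0 : t 0 = 0) :
    -- the duality identity, with absolute convergence of all expectations and integrals
    (∀ (s : Fin (n + 1) → unitInterval) (f g : ℝ → ℂ),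
      StrictMono s → 0 < s 0 → s (Fin.last n) < 1 →
      MemLp (fun x => (DualLaplace.h (s (Fin.last n)) x : ℂ) * f x) 2 DualLaplace.halfLine →
      DualLaplace.IsFourierSineTransform
        (fun x => (DualLaplace.h (s (Fin.last n)) x : ℂ) * f x) (fun y => (y : ℂ) * g y) →
      Integrable (fun ω =>
        (Real.exp (-∑ k : Fin n, ((t k.succ : ℝ) - t k.castSucc) * B (s k.castSucc) ω) : ℂ) *
          f (B (s (Fin.last n)) ω)) μ ∧
      (∀ y : ℝ, 0 < y → Integrable (fun ω =>
        (Real.exp (-(1 / 2) * ∑ k : Fin n,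
            ((s k.succ : ℝ) - s k.castSucc) * Y (t k.succ) ω ^ 2) : ℂ) *
          g (Y (t (Fin.last n)) ω)) (P y)) ∧
      IntegrableOn (fun y : ℝ =>
        (∫ ω, (Real.exp (-(1 / 2) * ∑ k : Fin n,
            ((s k.succ : ℝ) - s k.castSucc) * Y (t k.succ) ω ^ 2) : ℂ) *
          g (Y (t (Fin.last n)) ω) ∂(P y)) *
        ((y ^ 2 * Real.exp (-(1 / 2) * (s 0 : ℝ) * y ^ 2) : ℝ) : ℂ)) (Ioi 0) ∧
      ∫ ω, (Real.exp (-∑ k : Fin n,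
            ((t k.succ : ℝ) - t k.castSucc) * B (s k.castSucc) ω) : ℂ) *
          f (B (s (Fin.last n)) ω) ∂μ =
        2 * ∫ y in Ioi (0 : ℝ),
          (∫ ω, (Real.exp (-(1 / 2) * ∑ k : Fin n,
              ((s k.succ : ℝ) - s k.castSucc) * Y (t k.succ) ω ^ 2) : ℂ) *
            g (Y (t (Fin.last n)) ω) ∂(P y)) *
          ((y ^ 2 * Real.exp (-(1 / 2) * (s 0 : ℝ) * y ^ 2) : ℝ) : ℂ)) ∧
    -- the Laplace transform identity obtained from `f = 1`
    (∀ σ : Fin (n + 2) → unitInterval,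
      StrictMono σ → σ 0 = 0 → σ (Fin.last (n + 1)) = 1 →
      Integrable (fun ω => Real.exp (-∑ k : Fin n,
        ((t k.succ : ℝ) - t k.castSucc) * B (σ k.succ.castSucc) ω)) μ ∧
      IntegrableOn (fun y : ℝ =>
        (∫ ω, Real.exp (-(1 / 2) * ∑ k : Fin (n + 1),
          ((σ k.succ : ℝ) - σ k.castSucc) * Y (t k) ω ^ 2) ∂(P y)) * y ^ 2) (Ioi 0) ∧
      ∫ ω, Real.exp (-∑ k : Fin n,
          ((t k.succ : ℝ) - t k.castSucc) * B (σ k.succ.castSucc) ω) ∂μ =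
        Real.sqrt (2 / Real.pi) * ∫ y in Ioi (0 : ℝ),
          (∫ ω, Real.exp (-(1 / 2) * ∑ k : Fin (n + 1),
            ((σ k.succ : ℝ) - σ k.castSucc) * Y (t k) ω ^ 2) ∂(P y)) * y ^ 2) := by
  obtain ⟨T, hT, hTt⟩ := DualLaplace.exists_strictMono_extension ht
  have hT0 : T 0 = 0 := by rw [← ht0, hTt]; rfl
  have hTpos : ∀ j, 0 < (T (j + 1) : ℝ) - T j := fun j =>
    sub_pos.2 (NNReal.coe_lt_coe.2 (hT j.lt_succ_self))
  simp only [hTt, Fin.val_succ, Fin.val_castSucc, Fin.val_last]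
  constructor
  · intro s f g hs hs0 hs1 hf hfg
    obtain ⟨S, hS, hsS⟩ := DualLaplace.exists_strictMono_extension
      (t := fun k => (s k : ℝ)) (fun i j hij => Subtype.coe_lt_coe.2 (hs hij))
    have hS0 : 0 < S 0 := (hsS 0) ▸ Subtype.coe_lt_coe.2 hs0
    have hS1 : S n < 1 := by
      have := Subtype.coe_lt_coe.2 hs1
      simpa [hsS] using this
    have hSpos : ∀ j, 0 < S (j + 1) - S j := fun j => sub_pos.2 (hS j.lt_succ_self)
    simp only [hsS, Fin.val_last] at hf hfg
    simp only [hsS, Fin.val_succ, Fin.val_castSucc]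
    have hE := DualLaplace.excursion_side hB hS hS0 hTpos hsS hS1 hf
    have hR := DualLaplace.radial_side (n := n) hY hT hT0 hSpos hS0 hfg.2.1
    refine ⟨hE.1, hR.1, hR.2.1, ?_⟩
    have hu := DualLaplace.killedPart_eq_sineTransform hS0 hTpos hSpos n
    have hu' := DualLaplace.isBddDensity_killedPart hS0 hTpos hSpos n
    have hp := DualLaplace.integral_sineTransform_mul_of_isFourierSineTransform
      (DualLaplace.isBddDensity_radialPart hS0 hTpos hSpos n) (hu ▸ hu') hfg
    rw [← hu] at hp
    exact hE.2.trans (hp.trans hR.2.2.symm)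
  · intro σ hσ hσ0 hσ1
    obtain ⟨Q, hQ, hσQ⟩ := DualLaplace.exists_strictMono_extension
      (t := fun k => (σ k : ℝ)) (fun i j hij => Subtype.coe_lt_coe.2 (hσ hij))
    have hQ0 : Q 0 = 0 := by
      have := hσQ 0
      simpa [hσ0] using this.symm
    have hQ1 : Q (n + 1) = 1 := by
      have := hσQ (Fin.last (n + 1))
      simpa [hσ1] using this.symm
    -- With f = 1 the last position is not observed, so any time strictly between `Q n` and 1 can
    -- serve as the last one.
    set S := DualLaplace.shiftedTimes Q n with hSdef
    have hS : StrictMono S := DualLaplace.strictMono_shiftedTimes hQ hQ1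
    have hQn : Q n < 1 := hQ1 ▸ hQ n.lt_succ_self
    have hSn : S n = (Q n + 1) / 2 := if_pos rfl
    have hS1 : S n < 1 := by rw [hSn]; linarith
    have hS0 : 0 < S 0 := by
      have h0 : 0 ≤ Q n := hQ0 ▸ hQ.monotone n.zero_le
      rw [hSdef, DualLaplace.shiftedTimes]
      split_ifs
      · linarith
      · exact hQ0 ▸ hQ Nat.zero_lt_one
    have hSpos : ∀ j, 0 < S (j + 1) - S j := fun j => sub_pos.2 (hS j.lt_succ_self)
    have hlt : ∀ k : Fin (n + 1), S k < 1 := fun k =>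
      (hS.monotone (Nat.lt_succ_iff.1 k.2)).trans_lt hS1
    let s : Fin (n + 1) → unitInterval := fun k =>
      ⟨S k, (hS0.trans_le (hS.monotone (Nat.zero_le _))).le, (hlt k).le⟩
    have hsS : ∀ k, (s k : ℝ) = S k := fun k => rfl
    have hsσ : ∀ k : Fin n, s k.castSucc = σ k.succ.castSucc := fun k => Subtype.ext (by
      rw [hsS, hσQ, hSdef, DualLaplace.shiftedTimes, if_neg (by simpa using k.2.ne)]
      rfl)
    set C : ℝ := 1 / √(2 * Real.pi) with hC
    have hCpos : 0 < C := by positivity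
    -- Chosen so that y g(y) is the sine transform of h at the last time.
    set g : ℝ → ℝ := fun y => C * Real.exp (-((1 - S n) * y ^ 2 / 2)) with hg
    have hh := DualLaplace.isBddDensity_h hS1
    have hh' : DualLaplace.sineTransform (DualLaplace.h (S n)) = fun y => y * g y := by
      funext y
      rw [DualLaplace.sineTransform_h hS1, hg]
      ring
    have hgb : DualLaplace.IsBddDensity fun y => y * g y := by
      have := (DualLaplace.isBddDensity_mul_exp_neg_sq (c := (1 - S n) / 2)
        (by linarith)).const_mul hCpos.le
      convert this using 2 with y
      rw [hg]; ring_nf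
    have hE := DualLaplace.excursion_side (f := fun _ => 1) hB hS hS0 hTpos hsS hS1
      (by simpa using hh.memLp_two)
    have hR := DualLaplace.radial_side (n := n) (g := fun y => (g y : ℂ)) hY hT hT0 hSpos hS0
      (by simpa using hgb.memLp_two)
    have hv := DualLaplace.isBddDensity_radialPart hS0 hTpos hSpos n
    -- As h itself is integrable, the L¹ form of Parseval is enough.
    have hp := DualLaplace.integral_sineTransform_mul (w := fun x => (DualLaplace.h (S n) x : ℂ))
      hv.integrable hh.integrable.ofReal
    rw [← DualLaplace.killedPart_eq_sineTransform hS0 hTpos hSpos n] at hp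
    have hsine : ∀ y, DualLaplace.sineIntegral (fun x => (DualLaplace.h (S n) x : ℂ)) y =
        (y : ℂ) * (g y : ℂ) := by
      intro y
      rw [← Complex.ofReal_mul, ← congrFun hh' y, DualLaplace.sineIntegral,
        DualLaplace.sineTransform, Complex.ofReal_mul, ← integral_complex_ofReal]
      congr 2
      funext x
      rw [mul_comm y x, Complex.ofReal_mul]
    simp only [hsine] at hp
    simp only [mul_one, hsσ] at hE
    have hkey := hE.2.trans (hp.trans hR.2.2.symm)
    simp only [hσQ, Fin.val_succ, Fin.val_castSucc]
    -- Because Y starts at y almost surely, the initial weight can be moved inside the expectation,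
    -- where it supplies the term of the sum at time 0.
    have hinner : ∀ y ∈ Ioi (0 : ℝ),
        (∫ ω, (Real.exp (-(1 / 2) * ∑ k : Fin n, (S (k + 1) - S k) * Y (T (k + 1)) ω ^ 2) : ℂ) *
          (g (Y (T n) ω) : ℂ) ∂(P y)) *
            ((y ^ 2 * Real.exp (-(1 / 2) * S 0 * y ^ 2) : ℝ) : ℂ) =
        (C : ℂ) * (((∫ ω, Real.exp (-(1 / 2) * ∑ k : Fin (n + 1),
          (Q (k + 1) - Q k) * Y (T k) ω ^ 2) ∂(P y)) * y ^ 2 : ℝ) : ℂ) := by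
      intro y hy
      obtain ⟨Z, x, hxy, hZ, hYZ⟩ := hY y hy
      have hae : ∀ᵐ ω ∂(P y), Real.exp (-(1 / 2) * ∑ k : Fin (n + 1),
          (Q (k + 1) - Q k) * Y (T k) ω ^ 2) =
          C⁻¹ * Real.exp (-(1 / 2) * S 0 * y ^ 2) * (Real.exp (-(1 / 2) * ∑ k : Fin n,
            (S (k + 1) - S k) * Y (T (k + 1)) ω ^ 2) * g (Y (T n) ω)) := by
        filter_upwards [hZ.start] with ω hω
        have hY0 : Y (T 0) ω = y := by rw [hYZ, hT0, hω, hxy]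
        rw [Fin.sum_univ_eq_sum_range (fun k => (Q (k + 1) - Q k) * Y (T k) ω ^ 2),
          Fin.sum_univ_eq_sum_range (fun k => (S (k + 1) - S k) * Y (T (k + 1)) ω ^ 2),
          DualLaplace.sum_shiftedTimes hQ0 hQ1 (fun k => Y (T k) ω ^ 2), hY0, hg]
        field_simp
        rw [← Real.exp_add, ← Real.exp_add]
        congr 1
        ring
      rw [integral_congr_ae hae, integral_const_mul]
      simp_rw [← Complex.ofReal_mul]
      rw [integral_complex_ofReal, ← Complex.ofReal_mul]
      congr 1
      field_simp
    have hI := hR.2.1.congr_fun hinner measurableSet_Ioi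
    rw [setIntegral_congr_fun measurableSet_Ioi hinner, integral_const_mul,
      integral_complex_ofReal, integral_complex_ofReal] at hkey
    refine ⟨hE.1.re.congr (ae_of_all _ fun ω => Complex.ofReal_re _), ?_, ?_⟩
    · have := (hI.const_mul (C : ℂ)⁻¹).re
      refine this.congr (ae_of_all _ fun y => ?_)
      have hC0 : (C : ℂ) ≠ 0 := Complex.ofReal_ne_zero.2 hCpos.ne'
      simp only
      rw [inv_mul_cancel_left₀ hC0, RCLike.re_eq_complex_re, Complex.ofReal_re]
    -- The constant is 2C = 2/√(2π) = √(2/π).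
    · have h2 : ((2 : ℝ) : ℂ) = 2 := by norm_num
      rw [← h2, ← mul_assoc, ← Complex.ofReal_mul, ← Complex.ofReal_mul, Complex.ofReal_inj] at hkey
      rw [hkey, hC]
      congr 1
      rw [show 2 / Real.pi = 2 ^ 2 / (2 * Real.pi) by field_simp, Real.sqrt_div (by positivity),
        Real.sqrt_sq (by positivity)]
      ring
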